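/- For real $x$ let $J_0(x)=\sum_{r\ge 0}\frac{(-1)^r}{(r!)^2}\left(\frac x2\right)^{2r}$ be the cylindrical Bessel function of order $0$. For $r\in\mathbb N$ put $$l_r(x,y)=r!\sum_{s=0}^{r}\frac{x^{r-s}y^s}{(s!)^2((r-s)!)^2},\qquad l_r(x_1,x_2,x_3)=r!\sum_{s=0}^{r}\frac{x_3^{\,r-s}}{s!\,((r-s)!)^2}\,l_s(x_1,x_2),$$ and for a real index $\nu$ (with $1/\Gamma=0$ at the poles of $\Gamma$) $$l_\nu(x,y)=\Gamma(\nu+1)\sum_{s=0}^{\infty}\frac{x^{\nu-s}y^s}{(s!)^2\,\Gamma(\nu-s+1)^2},\qquad l_\nu(x_1,x_2,x_3)=\Gamma(\nu+1)\sum_{s=0}^{\infty}\frac{x_3^{\,\nu-s}}{s!\,\Gamma(\nu-s+1)^2}\,l_s(x_1,x_2);$$ at $\nu=r\in\mathbb N$ these agree with the polynomials above. Let ${}_2F_1$ be the Gauss hypergeometric function and $K(k)=\int_0^{\pi/2}\frac{d\theta}{\sqrt{1-k^2\sin^2\theta}}$ the complete elliptic integral of the first kind. Integrals over $(-\infty,\infty)$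 are (possibly conditionally convergent) improper integrals, whose convergence is part of the claim; so is the convergence of all series. 1. For all real $a,b,x$: $\displaystyle J_0(ax)J_0(bx)=\sum_{r=0}^\infty \frac{(-1)^r}{r!}\,l_r(a^2,b^2)\left(\frac x2\right)^{2r}.$ 2. For all real $a,b$ with $|a|>|b|$: $$\int_{-\infty}^{\infty}J_0(ax)J_0(bx)\,dx=2\sqrt\pi\;l_{-1/2}(a^2,b^2)=\frac{4}{\pi|a|}\,K\!\left(\frac ba\right),$$ $$l_{-1/2}(a^2,b^2)=\Gamma\!\left(\tfrac12\right)\sum_{s=0}^\infty\frac{(a^2)^{-(1/2+s)}\,b^{2s}}{(s!)^2\,\Gamma(\frac12-s)^2}=\frac{1}{\sqrt\pi\,|a|}\;{}_2F_1\!\left(\tfrac12,\tfrac12;1;\tfrac{b^2}{a^2}\right),$$ where for $|k|<1$: $\displaystyle {}_2F_1\!\left(\tfrac12,\tfrac12;1;k^2\right)=\sum_{s=0}^\infty\left[\frac{(2s)!}{2^{2s}(s!)^2}\right]^2k^{2s}=\frac2\pi K(k).$ 3. For all real $a_1,a_2,a_3,x$: $\displaystyle J_0(a_1x)J_0(a_2x)J_0(a_3x)=\sum_{r=0}^\infty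 \frac{(-1)^r}{r!}\,l_r(a_1^2,a_2^2,a_3^2)\left(\frac x2\right)^{2r}.$ 4. For all real $a_1,a_2,a_3$ with $|a_3|>|a_2|>|a_1|$ and $|a_1|+|a_2|\le|a_3|$: $$\int_{-\infty}^{\infty}J_0(a_1x)J_0(a_2x)J_0(a_3x)\,dx=2\sqrt\pi\;l_{-1/2}(a_1^2,a_2^2,a_3^2),$$ $$l_{-1/2}(a_1^2,a_2^2,a_3^2)=\Gamma\!\left(\tfrac12\right)\sum_{s=0}^\infty\frac{(a_3^2)^{-(1/2+s)}}{s!\,\Gamma(\frac12-s)^2}\,l_s(a_1^2,a_2^2)=\frac{1}{\sqrt\pi\,|a_3|}\,F,$$ $$F=\sum_{s=0}^\infty\left[\frac{(2s)!}{2^{2s}(s!)^2}\right]^2\frac{s!\;l_s(a_1^2,a_2^2)}{a_3^{2s}},$$ that is, $F$ is the series ${}_2F_1\!\left(\frac12,\frac12;1;\hat f/a_3^2\right)$ in which each power $\hat f^{\,s}$ is replaced by $s!\,l_s(a_1^2,a_2^2)$. -/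

import Mathlib

open Filter Topology MeasureTheory
open scoped Nat

noncomputable section

/-- The cylindrical Bessel function of order zero,
`J₀(x) = ∑ (-1)^r (x/2)^(2r) / (r!)²`. -/
def besselJ0 (x : ℝ) : ℝ :=
  ∑' r : ℕ, (-1 : ℝ) ^ r * (x / 2) ^ (2 * r) / (r ! : ℝ) ^ 2

/-- The polynomials `l_r(x, y) = r! ∑_{s ≤ r} x^(r-s) y^s / ((s!)² ((r-s)!)²)`. -/
def prodPoly (r : ℕ) (x y : ℝ) : ℝ :=
  (r ! : ℝ) * ∑ s ∈ Finset.range (r + 1),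
    x ^ (r - s) * y ^ s / ((s ! : ℝ) ^ 2 * ((r - s)! : ℝ) ^ 2)

/-- The polynomials
`l_r(x₁, x₂, x₃) = r! ∑_{s ≤ r} x₃^(r-s) / (s! ((r-s)!)²) * l_s(x₁, x₂)`. -/
def prodPoly3 (r : ℕ) (x₁ x₂ x₃ : ℝ) : ℝ :=
  (r ! : ℝ) * ∑ s ∈ Finset.range (r + 1),
    x₃ ^ (r - s) / ((s ! : ℝ) * ((r - s)! : ℝ) ^ 2) * prodPoly s x₁ x₂

/-- The function `l_ν(x, y)` of a real index `ν`, obtained by replacing factorials by the Gamma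
function: `l_ν(x, y) = Γ(ν+1) ∑_{s ≥ 0} x^(ν-s) y^s / ((s!)² Γ(ν-s+1)²)`.
Here `1 / Γ` vanishes at the non-positive integers (in Mathlib `Γ` is `0` there and `1 / 0 = 0`),
so that the series stops at `s = ν` when `ν` is a natural number. -/
def prodFun (ν x y : ℝ) : ℝ :=
  Real.Gamma (ν + 1) * ∑' s : ℕ,
    x ^ (ν - (s : ℝ)) * y ^ s / ((s ! : ℝ) ^ 2 * Real.Gamma (ν - s + 1) ^ 2)

/-- The function `l_ν(x₁, x₂, x₃)` of a real index `ν`: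
`l_ν(x₁, x₂, x₃) = Γ(ν+1) ∑_{s ≥ 0} x₃^(ν-s) / (s! Γ(ν-s+1)²) * l_s(x₁, x₂)`. -/
def prodFun3 (ν x₁ x₂ x₃ : ℝ) : ℝ :=
  Real.Gamma (ν + 1) * ∑' s : ℕ,
    x₃ ^ (ν - (s : ℝ)) / ((s ! : ℝ) * Real.Gamma (ν - s + 1) ^ 2) * prodPoly s x₁ x₂

/-- The complete elliptic integral of the first kind of modulus `k`,
`K(k) = ∫_0^{π/2} dθ / √(1 - k² sin² θ)`. -/
def ellipticK (k : ℝ) : ℝ :=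
  ∫ θ in (0 : ℝ)..(Real.pi / 2), 1 / √(1 - k ^ 2 * Real.sin θ ^ 2)

/-- The umbral Gauss hypergeometric function: the power series `₂F₁(a, b; c; t f)` in which the
power `f ^ n` is replaced by the number `m n`. -/
def umbral2F1 (a b c : ℝ) (m : ℕ → ℝ) (t : ℝ) : ℝ :=
  ∑' n : ℕ, ordinaryHypergeometricCoefficient a b c n * (m n * t ^ n)

/-- `f` is integrable on bounded intervals, and its improper integral over `(-∞, ∞)` converges
(both limits of integration being sent to infinity independently) with value `I`. -/
def HasImproperIntegral (f : ℝ → ℝ) (I : ℝ) : Prop :=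
  (∀ A B : ℝ, IntervalIntegrable f volume A B) ∧
    Tendsto (fun p : ℝ × ℝ => ∫ x in p.1..p.2, f x) (atBot ×ˢ atTop) (𝓝 I)

end

/-!
The series expansions of the products are Cauchy products of the power series of `J₀`.

For the integrals, `J₀` is written as the characteristic function of the arcsine law, the law of
`cos θ` with `θ` uniform on `(0, π]` (`besselJ0_eq_integral`). If `t₁, t₂` are independent with that
law, then `J₀(a₁x) J₀(a₂x)` is the mean of `cos (cx)` over the random frequency
`c = a₁ t₁ + a₂ t₂`, which is bounded by `|a₁| + |a₂|` and whose even moments are the numbers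
`β_s s! l_s(a₁², a₂²)`, with `β_s = (2s)! / (4^s (s!)²)` (`integral_frequency_pow`).

The Laplace transform of `J₀(ax)` satisfies a first order differential equation, hence is
`(p² + a²)^(-1/2)` on the right half-plane (`besselLaplace_eq`). At `p = ε + ic` with `ε → 0` it
tends to `(a² - c²)^(-1/2)` as long as `|c| < a`. Averaging over `c` and expanding by the binomial
series, with coefficients `β_s` again, gives the Abel mean of the integral of the triple product
over `(0, ∞)`: it is `1 / a₃` times the sum of `β_s² s! l_s(a₁², a₂²) / a₃^(2s)`, provided that
`|a₁| + |a₂| < a₃` (`tendsto_integral_exp_mul_triple`, `hasSum_wallisCoeff_sq_mul_prodPoly`).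

The Abel mean is the improper integral as soon as the latter converges
(`tendsto_integral_exp_mul_of_tendsto`). An energy estimate for Bessel's equation shows that `J₀` and
`J₀'` are `O(x^(-1/2))`, so that the triple product is absolutely integrable when no frequency
vanishes; when `a₁ = 0`, convergence comes from the Wronskian of the two remaining factors
(`exists_tendsto_integral_besselJ0_mul`). The boundary case `|a₁| + |a₂| = a₃` is a limit of
interior cases (`hasSum_triple_of_le`), and the product of two factors is the case `a₁ = 0`.
-/

/-! ### Wallis coefficients and series expansions -/

/-- The coefficient `(2n)! / (4ⁿ (n!)²)` of `zⁿ` in `(1 - z)^(-1/2)`, which is also the mean of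
`cos²ⁿ` over a period. -/
noncomputable def wallisCoeff (n : ℕ) : ℝ := ((2 * n)! : ℝ) / (2 ^ (2 * n) * (n ! : ℝ) ^ 2)

lemma wallisCoeff_zero : wallisCoeff 0 = 1 := by simp [wallisCoeff]

lemma wallisCoeff_succ (n : ℕ) :
    wallisCoeff (n + 1) = wallisCoeff n * ((2 * n + 1) / (2 * n + 2)) := by
  unfold wallisCoeff
  have h1 : (n ! : ℝ) ≠ 0 := by positivity
  rw [show 2 * (n + 1) = 2 * n + 1 + 1 by ring]
  simp only [Nat.factorial_succ]
  push_cast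
  field_simp
  ring

lemma wallisCoeff_pos (n : ℕ) : 0 < wallisCoeff n := by
  unfold wallisCoeff; positivity

lemma wallisCoeff_le_one (n : ℕ) : wallisCoeff n ≤ 1 := by
  induction n with
  | zero => simp [wallisCoeff_zero]
  | succ n ih =>
    rw [wallisCoeff_succ]
    have h : ((2 * n + 1) / (2 * n + 2) : ℝ) ≤ 1 := by
      rw [div_le_one (by positivity)]; linarith
    exact mul_le_one₀ ih (by positivity) h

lemma ascPochhammer_half_eval (n : ℕ) :
    (ascPochhammer ℝ n).eval (1 / 2 : ℝ) = (n ! : ℝ) * wallisCoeff n := by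
  induction n with
  | zero => simp [wallisCoeff_zero]
  | succ n ih =>
    rw [ascPochhammer_succ_eval, ih, wallisCoeff_succ, Nat.factorial_succ]
    push_cast
    field_simp
    ring

lemma ordinaryHypergeometricCoefficient_half (n : ℕ) :
    ordinaryHypergeometricCoefficient (1 / 2 : ℝ) (1 / 2) 1 n = wallisCoeff n ^ 2 := by
  have h1 : (n ! : ℝ) ≠ 0 := by positivity
  rw [ordinaryHypergeometricCoefficient, ascPochhammer_half_eval, ascPochhammer_eval_one]
  field_simp

/-- The binomial series `(1 - z)^(-1/2) = ∑ (2n)! / (4ⁿ (n!)²) zⁿ`. -/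
lemma hasSum_wallisCoeff_mul_pow {z : ℝ} (hz : |z| < 1) :
    HasSum (fun n => wallisCoeff n * z ^ n) ((1 - z) ^ (-1 / 2 : ℝ)) := by
  have h := (Real.one_add_rpow_hasFPowerSeriesOnBall_zero (a := (-1 / 2 : ℝ))).hasSum
    (y := -z) (by simpa [enorm_eq_nnnorm, ← NNReal.coe_lt_coe] using hz)
  rw [binomialSeries_eq_ordinaryHypergeometricSeries (b := (1 : ℝ))
    (fun k => by have : (0 : ℝ) ≤ k := k.cast_nonneg; linarith)] at h
  simp only [zero_add, FormalMultilinearSeries.compContinuousLinearMap_apply] at h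
  convert! h using 1
  · funext n
    have h1 : (n ! : ℝ) ≠ 0 := by positivity
    have e : (⇑(-(ContinuousLinearMap.id ℝ ℝ)) ∘ fun _ : Fin n => -z) = fun _ => z := by
      ext; simp
    rw [e, ordinaryHypergeometricSeries_apply_eq, show (-(-1 / 2) : ℝ) = 1 / 2 by norm_num,
      ascPochhammer_half_eval, ascPochhammer_eval_one, smul_eq_mul]
    field_simp

lemma inv_Gamma_half_sub (s : ℕ) :
    (Real.Gamma (1 / 2 - s))⁻¹ = (-1) ^ s * (s ! : ℝ) * wallisCoeff s / √Real.pi := by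
  induction s with
  | zero => rw [Nat.cast_zero, sub_zero, Real.Gamma_one_half_eq]; simp [wallisCoeff_zero]
  | succ s ih =>
    have hs : (1 / 2 - ((s + 1 : ℕ) : ℝ)) ≠ 0 := by
      push_cast; have : (0 : ℝ) ≤ s := s.cast_nonneg; linarith
    have h := Real.Gamma_add_one hs
    rw [show (1 / 2 - ((s + 1 : ℕ) : ℝ)) + 1 = 1 / 2 - s by push_cast; ring] at h
    have h2 : (Real.Gamma (1 / 2 - ((s + 1 : ℕ) : ℝ)))⁻¹
        = (1 / 2 - ((s + 1 : ℕ) : ℝ)) * (Real.Gamma (1 / 2 - s))⁻¹ := by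
      rw [h, mul_inv, mul_inv_cancel_left₀ hs]
    rw [h2, ih, wallisCoeff_succ, Nat.factorial_succ]
    push_cast
    field_simp
    ring

lemma Gamma_half_div_sq (s : ℕ) :
    Real.Gamma (1 / 2) * (Real.Gamma (1 / 2 - s) ^ 2)⁻¹
      = ((s ! : ℝ) * wallisCoeff s) ^ 2 / √Real.pi := by
  have hpi : √Real.pi ≠ 0 := by positivity
  have e : ((-1 : ℝ) ^ s) ^ 2 = 1 := by rw [← pow_mul, mul_comm, pow_mul]; simp
  rw [Real.Gamma_one_half_eq, ← inv_pow, inv_Gamma_half_sub, div_pow, mul_pow, mul_pow, e]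
  field_simp

/-! ### The Bessel series and its products -/

lemma hasSum_besselJ0 (x : ℝ) :
    HasSum (fun r : ℕ => (-1 : ℝ) ^ r * (x / 2) ^ (2 * r) / (r ! : ℝ) ^ 2) (besselJ0 x) := by
  refine Summable.hasSum ?_
  refine Summable.of_norm_bounded (Real.summable_pow_div_factorial ((x / 2) ^ 2)) fun r => ?_
  have h1 : (1 : ℝ) ≤ r ! := by exact_mod_cast Nat.one_le_iff_ne_zero.2 r.factorial_ne_zero
  rw [norm_div, norm_mul, norm_pow, norm_neg, norm_one, one_pow, one_mul, pow_mul,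
    Real.norm_of_nonneg (by positivity), Real.norm_of_nonneg (by positivity)]
  gcongr
  nlinarith

lemma HasSum.cauchy_product {f g : ℕ → ℝ} {a b : ℝ} (hf : HasSum f a) (hg : HasSum g b) :
    HasSum (fun n => ∑ k ∈ Finset.range (n + 1), f k * g (n - k)) (a * b) := by
  have h := (summable_norm_sum_mul_range_of_summable_norm hf.summable.norm
    hg.summable.norm).of_norm.hasSum
  rwa [← tsum_mul_tsum_eq_tsum_sum_range_of_summable_norm hf.summable.norm hg.summable.norm,
    hf.tsum_eq, hg.tsum_eq] at h

lemma hasSum_besselJ0_mul (a b x : ℝ) :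
    HasSum (fun r : ℕ => (-1 : ℝ) ^ r / (r ! : ℝ) * prodPoly r (a ^ 2) (b ^ 2)
      * (x / 2) ^ (2 * r)) (besselJ0 (a * x) * besselJ0 (b * x)) := by
  rw [mul_comm (besselJ0 _)]
  convert (hasSum_besselJ0 (b * x)).cauchy_product (hasSum_besselJ0 (a * x)) using 2 with r
  rw [prodPoly, Finset.mul_sum, Finset.mul_sum, Finset.sum_mul]
  refine Finset.sum_congr rfl fun s hs => ?_
  obtain ⟨t, rfl⟩ := Nat.exists_eq_add_of_le (Finset.mem_range_succ_iff.1 hs)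
  have h1 : (s ! : ℝ) ≠ 0 := by positivity
  have h2 : (t ! : ℝ) ≠ 0 := by positivity
  have h3 : ((s + t)! : ℝ) ≠ 0 := by positivity
  simp only [Nat.add_sub_cancel_left, pow_mul, pow_add, div_pow, mul_pow]
  field_simp

lemma hasSum_besselJ0_mul_mul (a₁ a₂ a₃ x : ℝ) :
    HasSum (fun r : ℕ => (-1 : ℝ) ^ r / (r ! : ℝ) * prodPoly3 r (a₁ ^ 2) (a₂ ^ 2) (a₃ ^ 2)
      * (x / 2) ^ (2 * r)) (besselJ0 (a₁ * x) * besselJ0 (a₂ * x) * besselJ0 (a₃ * x)) := by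
  convert (hasSum_besselJ0_mul a₁ a₂ x).cauchy_product (hasSum_besselJ0 (a₃ * x)) using 2 with r
  rw [prodPoly3, Finset.mul_sum, Finset.mul_sum, Finset.sum_mul]
  refine Finset.sum_congr rfl fun s hs => ?_
  obtain ⟨t, rfl⟩ := Nat.exists_eq_add_of_le (Finset.mem_range_succ_iff.1 hs)
  have h1 : (s ! : ℝ) ≠ 0 := by positivity
  have h2 : (t ! : ℝ) ≠ 0 := by positivity
  have h3 : ((s + t)! : ℝ) ≠ 0 := by positivity
  simp only [Nat.add_sub_cancel_left, pow_mul, pow_add, div_pow, mul_pow]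
  field_simp

/-! ### Non-negative integral indices -/

lemma Gamma_natCast_sub_add_one {r s : ℕ} (h : s ≤ r) :
    Real.Gamma ((r : ℝ) - s + 1) = ((r - s)! : ℝ) := by
  rw [← Nat.cast_sub h, Real.Gamma_nat_eq_factorial]

lemma Gamma_natCast_sub_add_one_eq_zero {r s : ℕ} (h : r < s) :
    Real.Gamma ((r : ℝ) - s + 1) = 0 := by
  obtain ⟨t, rfl⟩ := Nat.exists_eq_add_of_lt h
  have : ((r : ℝ) - ((r + t + 1 : ℕ) : ℝ) + 1) = -(t : ℝ) := by push_cast; ring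
  rw [this, Real.Gamma_neg_nat_eq_zero]

lemma rpow_natCast_sub {r s : ℕ} (h : s ≤ r) (x : ℝ) :
    x ^ ((r : ℝ) - (s : ℝ)) = x ^ (r - s) := by
  rw [← Nat.cast_sub h, Real.rpow_natCast]

lemma prodFun_natCast (r : ℕ) (x y : ℝ) : prodFun r x y = prodPoly r x y := by
  rw [prodFun, prodPoly, Real.Gamma_nat_eq_factorial, tsum_eq_sum (s := Finset.range (r + 1))]
  · congr 1
    refine Finset.sum_congr rfl fun s hs => ?_
    have hs := Finset.mem_range_succ_iff.1 hs
    rw [Gamma_natCast_sub_add_one hs, rpow_natCast_sub hs]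
  · intro s hs
    rw [Gamma_natCast_sub_add_one_eq_zero (by simpa using hs)]
    simp

lemma prodFun3_natCast (r : ℕ) (x₁ x₂ x₃ : ℝ) :
    prodFun3 r x₁ x₂ x₃ = prodPoly3 r x₁ x₂ x₃ := by
  rw [prodFun3, prodPoly3, Real.Gamma_nat_eq_factorial, tsum_eq_sum (s := Finset.range (r + 1))]
  · congr 1
    refine Finset.sum_congr rfl fun s hs => ?_
    have hs := Finset.mem_range_succ_iff.1 hs
    rw [Gamma_natCast_sub_add_one hs, rpow_natCast_sub hs]
  · intro s hs
    rw [Gamma_natCast_sub_add_one_eq_zero (by simpa using hs)]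
    simp

/-! ### The arcsine law and the integral representation of `J₀` -/

/-- The arcsine law on `[-1, 1]`: the distribution of `cos θ` for `θ` uniform on `(0, π]`.
Its characteristic function is `J₀`. -/
noncomputable def arcsineMeasure : Measure ℝ :=
  ENNReal.ofReal Real.pi⁻¹ • (volume.restrict (Set.Ioc 0 Real.pi)).map Real.cos

instance : IsProbabilityMeasure arcsineMeasure := by
  constructor
  rw [arcsineMeasure, Measure.smul_apply, Measure.map_apply Real.measurable_cos MeasurableSet.univ]
  simp only [Set.preimage_univ, Measure.restrict_apply MeasurableSet.univ, Set.univ_inter,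
    Real.volume_Ioc, sub_zero, smul_eq_mul]
  rw [← ENNReal.ofReal_mul (by positivity), inv_mul_cancel₀ Real.pi_ne_zero, ENNReal.ofReal_one]

lemma abs_le_one_ae_arcsineMeasure : ∀ᵐ t ∂arcsineMeasure, |t| ≤ 1 := by
  refine Measure.ae_smul_measure ?_ _
  rw [ae_map_iff Real.measurable_cos.aemeasurable (measurableSet_le (by fun_prop) (by fun_prop))]
  exact ae_of_all _ Real.abs_cos_le_one

lemma integral_arcsineMeasure {f : ℝ → ℝ} (hf : Continuous f) :
    ∫ t, f t ∂arcsineMeasure = Real.pi⁻¹ * ∫ θ in (0 : ℝ)..Real.pi, f (Real.cos θ) := by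
  rw [arcsineMeasure, integral_smul_measure,
    integral_map Real.measurable_cos.aemeasurable hf.aestronglyMeasurable,
    intervalIntegral.integral_of_le Real.pi_pos.le, ENNReal.toReal_ofReal (by positivity),
    smul_eq_mul]

lemma integrable_arcsineMeasure {f : ℝ → ℝ} (hf : Continuous f) :
    Integrable f arcsineMeasure := by
  obtain ⟨C, hC⟩ := (isCompact_Icc (a := (-1 : ℝ)) (b := 1)).exists_bound_of_continuousOn
    hf.continuousOn
  refine Integrable.of_bound hf.aestronglyMeasurable C ?_
  filter_upwards [abs_le_one_ae_arcsineMeasure] with t ht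
  exact hC t (abs_le.1 ht)

lemma integral_pow_add_two_arcsineMeasure (n : ℕ) :
    ∫ t, t ^ (n + 2) ∂arcsineMeasure = (n + 1) / (n + 2) * ∫ t, t ^ n ∂arcsineMeasure := by
  rw [integral_arcsineMeasure (by fun_prop), integral_arcsineMeasure (by fun_prop),
    integral_cos_pow]
  simp
  ring

lemma integral_pow_even_arcsineMeasure (n : ℕ) :
    ∫ t, t ^ (2 * n) ∂arcsineMeasure = wallisCoeff n := by
  induction n with
  | zero => simp [wallisCoeff_zero]
  | succ n ih =>
    rw [mul_add, mul_one, integral_pow_add_two_arcsineMeasure, ih, wallisCoeff_succ]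
    push_cast
    ring

lemma integral_pow_odd_arcsineMeasure (n : ℕ) :
    ∫ t, t ^ (2 * n + 1) ∂arcsineMeasure = 0 := by
  induction n with
  | zero => rw [integral_arcsineMeasure (by fun_prop)]; simp
  | succ n ih =>
    rw [show 2 * (n + 1) + 1 = 2 * n + 1 + 2 by ring, integral_pow_add_two_arcsineMeasure, ih,
      mul_zero]

lemma abs_integral_le_of_abs_le {f : ℝ → ℝ} (C : ℝ) (h : ∀ t, |t| ≤ 1 → |f t| ≤ C) :
    |∫ t, f t ∂arcsineMeasure| ≤ C := by
  have := norm_integral_le_of_norm_le_const (μ := arcsineMeasure) (f := f) (C := C)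
    (abs_le_one_ae_arcsineMeasure.mono fun t ht => h t ht)
  simpa using this

lemma besselJ0_eq_integral (x : ℝ) : besselJ0 x = ∫ t, Real.cos (x * t) ∂arcsineMeasure := by
  refine (hasSum_besselJ0 x).unique ?_
  have h := hasSum_integral_of_dominated_convergence (μ := arcsineMeasure)
    (F := fun n t => (-1 : ℝ) ^ n * (x * t) ^ (2 * n) / ((2 * n)! : ℝ))
    (f := fun t => Real.cos (x * t))
    (fun n _ => |x| ^ (2 * n) / ((2 * n)! : ℝ))
    (fun n => by fun_prop) ?_ (ae_of_all _ fun _ => (Real.hasSum_cosh |x|).summable)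
    (integrable_const _) (ae_of_all _ fun t => Real.hasSum_cos (x * t))
  · convert! h using 2 with n
    have e : ∀ t : ℝ, (-1 : ℝ) ^ n * (x * t) ^ (2 * n) / ((2 * n)! : ℝ)
        = ((-1 : ℝ) ^ n * x ^ (2 * n) / ((2 * n)! : ℝ)) * t ^ (2 * n) := fun t => by
      rw [mul_pow]; ring
    simp only [e]
    rw [integral_const_mul, integral_pow_even_arcsineMeasure, wallisCoeff, div_pow]
    have h1 : ((2 * n)! : ℝ) ≠ 0 := by positivity
    field_simp
  · intro n
    filter_upwards [abs_le_one_ae_arcsineMeasure] with t ht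
    simp only [norm_div, norm_mul, norm_pow, norm_neg, norm_one, one_pow, one_mul,
      Real.norm_eq_abs, Nat.abs_cast]
    gcongr
    exact mul_le_of_le_one_right (abs_nonneg _) ht

lemma integral_sin_mul_arcsineMeasure (x : ℝ) : ∫ t, Real.sin (x * t) ∂arcsineMeasure = 0 := by
  have h := hasSum_integral_of_dominated_convergence (μ := arcsineMeasure)
    (F := fun n t => (-1 : ℝ) ^ n * (x * t) ^ (2 * n + 1) / ((2 * n + 1)! : ℝ))
    (f := fun t => Real.sin (x * t))
    (fun n _ => |x| ^ (2 * n + 1) / ((2 * n + 1)! : ℝ))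
    (fun n => by fun_prop) ?_ (ae_of_all _ fun _ => (Real.hasSum_sinh |x|).summable)
    (integrable_const _) (ae_of_all _ fun t => Real.hasSum_sin (x * t))
  · refine h.unique ?_
    convert! hasSum_zero (α := ℝ) (β := ℕ) using 2 with n
    have e : ∀ t : ℝ, (-1 : ℝ) ^ n * (x * t) ^ (2 * n + 1) / ((2 * n + 1)! : ℝ)
        = ((-1 : ℝ) ^ n * x ^ (2 * n + 1) / ((2 * n + 1)! : ℝ)) * t ^ (2 * n + 1) := fun t => by
      rw [mul_pow]; ring
    simp only [e]
    rw [integral_const_mul, integral_pow_odd_arcsineMeasure, mul_zero]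
  · intro n
    filter_upwards [abs_le_one_ae_arcsineMeasure] with t ht
    simp only [norm_div, norm_mul, norm_pow, norm_neg, norm_one, one_pow, one_mul,
      Real.norm_eq_abs, Nat.abs_cast]
    gcongr
    exact mul_le_of_le_one_right (abs_nonneg _) ht

/-! ### Derivatives, the Bessel equation, and decay -/

/-- The derivative of `J₀`, in integral form. -/
noncomputable def besselJ0Deriv (x : ℝ) : ℝ := ∫ t, -(t * Real.sin (x * t)) ∂arcsineMeasure

/-- The second derivative of `J₀`, in integral form. -/
noncomputable def besselJ0Deriv2 (x : ℝ) : ℝ := ∫ t, -(t ^ 2 * Real.cos (x * t)) ∂arcsineMeasure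

lemma hasDerivAt_besselJ0 (x : ℝ) : HasDerivAt besselJ0 (besselJ0Deriv x) x := by
  have e : besselJ0 = fun x => ∫ t, Real.cos (x * t) ∂arcsineMeasure :=
    funext besselJ0_eq_integral
  rw [e]
  refine (hasDerivAt_integral_of_dominated_loc_of_deriv_le
    (F := fun x t => Real.cos (x * t)) (F' := fun x t => -(t * Real.sin (x * t)))
    (bound := fun _ => 1) univ_mem
    (Eventually.of_forall fun x => by fun_prop) (integrable_arcsineMeasure (by fun_prop))
    (by fun_prop) ?_ (integrable_const _) (ae_of_all _ fun t x _ => ?_)).2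
  · filter_upwards [abs_le_one_ae_arcsineMeasure] with t ht x _
    rw [norm_neg, norm_mul, Real.norm_eq_abs, Real.norm_eq_abs]
    exact mul_le_one₀ ht (abs_nonneg _) (Real.abs_sin_le_one _)
  · have := ((hasDerivAt_id x).mul_const t).cos
    simp only [id, one_mul] at this
    exact this.congr_deriv (by ring)

lemma hasDerivAt_besselJ0Deriv (x : ℝ) : HasDerivAt besselJ0Deriv (besselJ0Deriv2 x) x := by
  refine (hasDerivAt_integral_of_dominated_loc_of_deriv_le
    (F := fun x t => -(t * Real.sin (x * t))) (F' := fun x t => -(t ^ 2 * Real.cos (x * t)))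
    (bound := fun _ => 1) univ_mem
    (Eventually.of_forall fun x => by fun_prop) (integrable_arcsineMeasure (by fun_prop))
    (by fun_prop) ?_ (integrable_const _) (ae_of_all _ fun t x _ => ?_)).2
  · filter_upwards [abs_le_one_ae_arcsineMeasure] with t ht x _
    rw [norm_neg, norm_mul, norm_pow, Real.norm_eq_abs, Real.norm_eq_abs]
    exact mul_le_one₀ (pow_le_one₀ (abs_nonneg _) ht) (abs_nonneg _) (Real.abs_cos_le_one _)
  · have := (((hasDerivAt_id x).mul_const t).sin.const_mul t).neg
    simp only [id, one_mul] at this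
    exact this.congr_deriv (by ring)

lemma continuous_besselJ0 : Continuous besselJ0 :=
  continuous_iff_continuousAt.2 fun x => (hasDerivAt_besselJ0 x).continuousAt

lemma continuous_besselJ0Deriv : Continuous besselJ0Deriv :=
  continuous_iff_continuousAt.2 fun x => (hasDerivAt_besselJ0Deriv x).continuousAt

lemma besselJ0_zero : besselJ0 0 = 1 := by simp [besselJ0_eq_integral]

lemma besselJ0_neg (x : ℝ) : besselJ0 (-x) = besselJ0 x := by
  simp [besselJ0_eq_integral]

lemma besselJ0_abs_mul (a x : ℝ) : besselJ0 (|a| * x) = besselJ0 (a * x) := by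
  rcases abs_choice a with h | h <;> rw [h]
  rw [neg_mul, besselJ0_neg]

lemma abs_besselJ0_le_one (x : ℝ) : |besselJ0 x| ≤ 1 := by
  rw [besselJ0_eq_integral]
  exact abs_integral_le_of_abs_le _ fun t _ => Real.abs_cos_le_one _

lemma abs_besselJ0Deriv_le_one (x : ℝ) : |besselJ0Deriv x| ≤ 1 := by
  refine abs_integral_le_of_abs_le _ fun t ht => ?_
  rw [abs_neg, abs_mul]
  exact mul_le_one₀ ht (abs_nonneg _) (Real.abs_sin_le_one _)

/-- Bessel's equation of order zero. Under the integral representation the left side is the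
integral over `(0, π)` of the derivative of `-sin θ sin (x cos θ)`. -/
lemma bessel_equation (x : ℝ) :
    x * besselJ0Deriv2 x + besselJ0Deriv x + x * besselJ0 x = 0 := by
  have e : x * besselJ0Deriv2 x + besselJ0Deriv x + x * besselJ0 x
      = ∫ t, (x * -(t ^ 2 * Real.cos (x * t)) + -(t * Real.sin (x * t)) + x * Real.cos (x * t))
        ∂arcsineMeasure := by
    rw [integral_add (integrable_arcsineMeasure (by fun_prop))
      (integrable_arcsineMeasure (by fun_prop)),
      integral_add (integrable_arcsineMeasure (by fun_prop))
      (integrable_arcsineMeasure (by fun_prop)), integral_const_mul, integral_const_mul,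
      besselJ0_eq_integral, besselJ0Deriv, besselJ0Deriv2]
  rw [e, integral_arcsineMeasure (by fun_prop),
    intervalIntegral.integral_eq_sub_of_hasDerivAt
      (f := fun θ => -(Real.sin θ * Real.sin (x * Real.cos θ)))]
  · simp
  · intro θ _
    have h := ((Real.hasDerivAt_sin θ).mul (((Real.hasDerivAt_cos θ).const_mul x).sin)).neg
    refine h.congr_deriv ?_
    rw [Real.cos_sq']
    ring
  · exact Continuous.intervalIntegrable (by fun_prop) _ _

/-- The energy `u'² + (1 + 1 / (4x²)) u²` of `u = √x J₀(x)`, which is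
`x J₀'² + J₀ J₀' + x J₀² + J₀² / (2x)`, is non-increasing; this gives
the decay of `J₀` and of its derivative. -/
lemma besselJ0_sq_add_deriv_sq_le {x : ℝ} (hx : 0 < x) :
    besselJ0 x ^ 2 + besselJ0Deriv x ^ 2 ≤ 7 / x := by
  have hb1 : ∀ x, besselJ0 x ^ 2 ≤ 1 := fun x => (sq_le_one_iff_abs_le_one _).2
    (abs_besselJ0_le_one x)
  have hb2 : ∀ x, besselJ0Deriv x ^ 2 ≤ 1 := fun x => (sq_le_one_iff_abs_le_one _).2
    (abs_besselJ0Deriv_le_one x)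
  rw [le_div_iff₀ hx]
  rcases le_total x 1 with h1 | h1
  · nlinarith [hb1 x, hb2 x, sq_nonneg (besselJ0 x), sq_nonneg (besselJ0Deriv x)]
  let E : ℝ → ℝ := fun x => x * besselJ0Deriv x ^ 2 + besselJ0 x * besselJ0Deriv x
    + x * besselJ0 x ^ 2 + besselJ0 x ^ 2 / (2 * x)
  have hE : ∀ y : ℝ, 0 < y → HasDerivAt E (-(besselJ0 y ^ 2 / (2 * y ^ 2))) y := by
    intro y hy
    have d0 := hasDerivAt_besselJ0 y
    have d1 := hasDerivAt_besselJ0Deriv y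
    have hid := hasDerivAt_id' y
    have h := (((hid.mul (d1.pow 2)).add (d0.mul d1)).add (hid.mul (d0.pow 2))).add
      ((d0.pow 2).div (hid.const_mul 2) (by positivity))
    refine h.congr_deriv ?_
    have ode : besselJ0Deriv2 y = -(besselJ0Deriv y / y) - besselJ0 y := by
      have := bessel_equation y
      field_simp
      linarith
    rw [ode]
    simp only [Pi.pow_apply]
    field_simp
    ring
  have hanti : AntitoneOn E (Set.Ici 1) := by
    refine antitoneOn_of_deriv_nonpos (convex_Ici 1) (fun y hy => ?_) (fun y hy => ?_)
      fun y hy => ?_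
    · exact (hE y (zero_lt_one.trans_le hy)).continuousAt.continuousWithinAt
    all_goals
      rw [interior_Ici] at hy
      have hy0 : (0 : ℝ) < y := zero_lt_one.trans hy
    · exact (hE y hy0).differentiableAt.differentiableWithinAt
    · rw [(hE y hy0).deriv]
      exact neg_nonpos.2 (by positivity)
  have hle := hanti (Set.mem_Ici.2 le_rfl) (Set.mem_Ici.2 h1) h1
  simp only [E] at hle
  have h0 : 0 ≤ besselJ0 x ^ 2 / (2 * x) := by positivity
  nlinarith [hb1 1, hb2 1, sq_nonneg (besselJ0 1 - besselJ0Deriv 1),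
    sq_nonneg (besselJ0 x + besselJ0Deriv x), sq_nonneg (besselJ0 x),
    sq_nonneg (besselJ0Deriv x)]

lemma abs_besselJ0_le {x : ℝ} (hx : 0 < x) : |besselJ0 x| ≤ 3 / √x := by
  refine abs_le_of_sq_le_sq ?_ (by positivity)
  rw [div_pow, Real.sq_sqrt hx.le]
  have h := besselJ0_sq_add_deriv_sq_le hx
  have h2 : (7 : ℝ) / x ≤ 3 ^ 2 / x := by gcongr; norm_num
  nlinarith [sq_nonneg (besselJ0Deriv x)]

lemma abs_besselJ0Deriv_le {x : ℝ} (hx : 0 < x) : |besselJ0Deriv x| ≤ 3 / √x := by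
  refine abs_le_of_sq_le_sq ?_ (by positivity)
  rw [div_pow, Real.sq_sqrt hx.le]
  have h := besselJ0_sq_add_deriv_sq_le hx
  have h2 : (7 : ℝ) / x ≤ 3 ^ 2 / x := by gcongr; norm_num
  nlinarith [sq_nonneg (besselJ0 x)]

/-! ### Laplace transforms of bounded functions -/

lemma integrableOn_exp_mul_of_bounded {g : ℝ → ℝ} (hg : Continuous g) {C : ℝ}
    (hC : ∀ x, |g x| ≤ C) {ε : ℝ} (hε : 0 < ε) :
    IntegrableOn (fun x => Real.exp (-(ε * x)) * g x) (Set.Ioi 0) := by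
  have h := (exp_neg_integrableOn_Ioi 0 hε).mul_const C
  refine h.mono' (Continuous.aestronglyMeasurable (by fun_prop)) (ae_of_all _ fun x => ?_)
  rw [norm_mul, Real.norm_of_nonneg (Real.exp_pos _).le, neg_mul]
  exact mul_le_mul_of_nonneg_left (hC x) (Real.exp_pos _).le

/-- The Laplace transform of a bounded function, normalized by its parameter, tends to any limit
that the function has under the rescalings `x ↦ x / ε`. With `ε → 0` this is the final value
theorem, with `ε → ∞` the initial value theorem. -/
lemma tendsto_mul_integral_exp_mul {g : ℝ → ℝ} (hg : Continuous g) {C : ℝ}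
    (hC : ∀ x, |g x| ≤ C) {l : Filter ℝ} [l.IsCountablyGenerated] (hl : ∀ᶠ ε in l, 0 < ε) {L : ℝ}
    (h : ∀ u : ℝ, 0 < u → Tendsto (fun ε => g (u / ε)) l (𝓝 L)) :
    Tendsto (fun ε => ε * ∫ x in Set.Ioi (0 : ℝ), Real.exp (-(ε * x)) * g x) l (𝓝 L) := by
  have key : ∀ᶠ ε in l, ∫ u in Set.Ioi (0 : ℝ), Real.exp (-u) * g (u / ε)
      = ε * ∫ x in Set.Ioi (0 : ℝ), Real.exp (-(ε * x)) * g x := by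
    filter_upwards [hl] with ε hε
    have := integral_comp_mul_left_Ioi (fun u => Real.exp (-u) * g (u / ε)) 0 hε
    simp only [mul_zero, smul_eq_mul, mul_div_cancel_left₀ _ hε.ne'] at this
    rw [this, mul_inv_cancel_left₀ hε.ne']
  refine Tendsto.congr' key ?_
  have hL : L = ∫ u in Set.Ioi (0 : ℝ), Real.exp (-u) * L := by
    rw [integral_mul_const, integral_exp_neg_Ioi_zero, one_mul]
  conv => arg 3; rw [hL]
  have hb : IntegrableOn (fun u => Real.exp (-u) * C) (Set.Ioi 0) := by
    simpa [IntegrableOn] using (exp_neg_integrableOn_Ioi 0 one_pos).mul_const C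
  refine tendsto_integral_filter_of_dominated_convergence _ (Eventually.of_forall fun ε => ?_)
    (Eventually.of_forall fun ε => ae_of_all _ fun u => ?_) hb ?_
  · exact Continuous.aestronglyMeasurable (by fun_prop)
  · rw [norm_mul, Real.norm_of_nonneg (Real.exp_pos _).le]
    exact mul_le_mul_of_nonneg_left (hC _) (Real.exp_pos _).le
  · filter_upwards [ae_restrict_mem measurableSet_Ioi] with u hu
    exact (h u hu).const_mul _

lemma tendsto_exp_mul_bounded {S : ℝ → ℝ} {C : ℝ} (hC : ∀ x, |S x| ≤ C) {ε : ℝ} (hε : 0 < ε) :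
    Tendsto (fun x => Real.exp (-(ε * x)) * S x) atTop (𝓝 0) := by
  have h : Tendsto (fun x => Real.exp (-(ε * x))) atTop (𝓝 0) :=
    Real.tendsto_exp_neg_atTop_nhds_zero.comp (tendsto_id.const_mul_atTop hε)
  refine h.zero_mul_isBoundedUnder_le ?_
  exact isBoundedUnder_of ⟨C, fun x => by simpa using hC x⟩

/-- Abel's theorem for integrals: if the improper integral of a bounded continuous function over
`(0, ∞)` converges, its value is the limit of the Laplace transform at zero. -/
lemma tendsto_integral_exp_mul_of_tendsto {f : ℝ → ℝ} (hf : Continuous f) {C L : ℝ}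
    (hC : ∀ x, |f x| ≤ C)
    (hL : Tendsto (fun R => ∫ x in (0 : ℝ)..R, f x) atTop (𝓝 L)) :
    Tendsto (fun ε => ∫ x in Set.Ioi (0 : ℝ), Real.exp (-(ε * x)) * f x) (𝓝[>] 0) (𝓝 L) := by
  -- The primitive is extended by zero to the negative axis, so that it is bounded on the line.
  let S : ℝ → ℝ := fun R => ∫ x in (0 : ℝ)..(max R 0), f x
  have hprim : Continuous fun R => ∫ x in (0 : ℝ)..R, f x :=
    intervalIntegral.continuous_primitive (fun a b => hf.intervalIntegrable a b) 0
  have hS : Continuous S := hprim.comp (continuous_id.max continuous_const)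
  have hSL : Tendsto S atTop (𝓝 L) :=
    hL.comp (tendsto_atTop_mono (fun x => le_max_left x 0) tendsto_id)
  obtain ⟨D, hD⟩ : ∃ D, ∀ x, |S x| ≤ D := by
    obtain ⟨N, hN⟩ := eventually_atTop.1 (hSL.abs.eventually_le_const (lt_add_one |L|))
    obtain ⟨D, hD⟩ := (isCompact_Icc (a := (0 : ℝ)) (b := max N 0)).exists_bound_of_continuousOn
      hS.continuousOn
    refine ⟨max D (|L| + 1), fun x => ?_⟩
    rcases le_total N x with h | h
    · exact (hN x h).trans (le_max_right _ _)
    · have e : S x = S (max x 0) := by simp [S]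
      rw [e]
      exact (hD _ ⟨le_max_right _ _, max_le_max_right _ h⟩).trans (le_max_left _ _)
  have h := tendsto_mul_integral_exp_mul (l := 𝓝[>] (0 : ℝ)) hS hD self_mem_nhdsWithin (L := L)
    fun u hu => by
      simp only [div_eq_mul_inv]
      exact hSL.comp (tendsto_inv_nhdsGT_zero.const_mul_atTop hu)
  refine h.congr' ?_
  filter_upwards [self_mem_nhdsWithin] with ε hε
  have hε : 0 < ε := hε
  have hd : ∀ x ∈ Set.Ioi (0 : ℝ), HasDerivAt (fun x => Real.exp (-(ε * x)) * S x)
      (Real.exp (-(ε * x)) * f x - ε * (Real.exp (-(ε * x)) * S x)) x := by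
    intro x hx
    have h1 : HasDerivAt S (f x) x := by
      have := intervalIntegral.integral_hasDerivAt_right (hf.intervalIntegrable 0 x)
        (hf.stronglyMeasurableAtFilter _ _) hf.continuousAt
      refine this.congr_of_eventuallyEq ?_
      filter_upwards [lt_mem_nhds hx] with y hy
      simp only [S, max_eq_left (le_of_lt hy)]
    have h2 := ((((hasDerivAt_id' x).const_mul ε).neg).exp).mul h1
    exact h2.congr_deriv (by simp only [Pi.neg_apply]; ring)
  have i1 := integrableOn_exp_mul_of_bounded hf hC hε
  have i2 := (integrableOn_exp_mul_of_bounded hS hD hε).const_mul ε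
  have h3 := integral_Ioi_of_hasDerivAt_of_tendsto
    (Continuous.continuousWithinAt (by fun_prop)) hd (i1.sub i2) (tendsto_exp_mul_bounded hD hε)
  rw [integral_sub i1 i2, integral_const_mul] at h3
  have h0 : S 0 = 0 := by simp [S]
  rw [h0] at h3
  linarith

/-! ### The Laplace transform of `J₀` -/

lemma norm_cexp_neg_mul (p : ℂ) (x : ℝ) :
    ‖Complex.exp (-(p * x))‖ = Real.exp (-(p.re * x)) := by
  rw [Complex.norm_exp]; simp

lemma integrableOn_mul_exp_neg {b : ℝ} (hb : 0 < b) :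
    IntegrableOn (fun x : ℝ => x * Real.exp (-(b * x))) (Set.Ioi 0) := by
  simpa using integrableOn_rpow_mul_exp_neg_mul_rpow (s := 1) (p := 1) (by norm_num) one_pos hb

lemma integrableOn_cexp_mul {g : ℝ → ℝ} (hg : Continuous g) {C : ℝ} (hC : ∀ x, |g x| ≤ C)
    {p : ℂ} (hp : 0 < p.re) :
    IntegrableOn (fun x : ℝ => Complex.exp (-(p * x)) * (g x : ℂ)) (Set.Ioi 0) := by
  refine ((exp_neg_integrableOn_Ioi 0 hp).mul_const C).mono'
    (Continuous.aestronglyMeasurable (by fun_prop)) (ae_of_all _ fun x => ?_)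
  rw [norm_mul, norm_cexp_neg_mul, neg_mul, Complex.norm_real]
  exact mul_le_mul_of_nonneg_left (hC x) (Real.exp_pos _).le

lemma hasDerivAt_integral_cexp_mul {g : ℝ → ℝ} (hg : Continuous g) {C : ℝ}
    (hC : ∀ x, |g x| ≤ C) {p : ℂ} (hp : 0 < p.re) :
    IntegrableOn (fun x : ℝ => -(x * (Complex.exp (-(p * x)) * (g x : ℂ)))) (Set.Ioi 0) ∧
    HasDerivAt (fun p : ℂ => ∫ x in Set.Ioi (0 : ℝ), Complex.exp (-(p * x)) * (g x : ℂ))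
      (∫ x in Set.Ioi (0 : ℝ), -(x * (Complex.exp (-(p * x)) * (g x : ℂ)))) p := by
  refine hasDerivAt_integral_of_dominated_loc_of_deriv_le
    (s := {q : ℂ | p.re / 2 < q.re})
    (F := fun (p : ℂ) (x : ℝ) => Complex.exp (-(p * x)) * (g x : ℂ))
    (F' := fun (p : ℂ) (x : ℝ) => -(x * (Complex.exp (-(p * x)) * (g x : ℂ))))
    (bound := fun x => x * Real.exp (-(p.re / 2 * x)) * C)
    ((isOpen_lt continuous_const Complex.continuous_re).mem_nhds (half_lt_self hp))
    (Eventually.of_forall fun q => Continuous.aestronglyMeasurable (by fun_prop))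
    (integrableOn_cexp_mul hg hC hp) (Continuous.aestronglyMeasurable (by fun_prop)) ?_
    ((integrableOn_mul_exp_neg (half_pos hp)).mul_const C) (ae_of_all _ fun x q _ => ?_)
  · filter_upwards [ae_restrict_mem measurableSet_Ioi] with x hx q hq
    have hx : 0 < x := hx
    rw [norm_neg, norm_mul, norm_mul, norm_cexp_neg_mul, Complex.norm_real, Complex.norm_real,
      Real.norm_of_nonneg hx.le, mul_assoc]
    have h1 : Real.exp (-(q.re * x)) ≤ Real.exp (-(p.re / 2 * x)) := by
      rw [Real.exp_le_exp, neg_le_neg_iff]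
      exact mul_le_mul_of_nonneg_right (le_of_lt hq) hx.le
    exact mul_le_mul_of_nonneg_left
      (mul_le_mul h1 (hC x) (norm_nonneg _) (Real.exp_pos _).le) hx.le
  · have h := ((((hasDerivAt_id' q).mul_const (x : ℂ)).neg).cexp).mul_const (g x : ℂ)
    exact h.congr_deriv (by simp only [Pi.neg_apply]; ring)

/-- The Laplace transform of `x ↦ J₀(ax)`. -/
noncomputable def besselLaplace (a : ℝ) (p : ℂ) : ℂ :=
  ∫ x in Set.Ioi (0 : ℝ), Complex.exp (-(p * x)) * (besselJ0 (a * x) : ℂ)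

/-- The Laplace transform `G` of `J₀(ax)` satisfies `(p² + a²) G' + p G = 0`. With `y = J₀(ax)`,
Bessel's equation makes `e^{-px} (x y' + p x y)` a primitive of the integrand of the left side. -/
lemma hasDerivAt_besselLaplace (a : ℝ) {p : ℂ} (hp : 0 < p.re) :
    ∃ G' : ℂ, HasDerivAt (besselLaplace a) G' p ∧
      (p ^ 2 + (a : ℂ) ^ 2) * G' + p * besselLaplace a p = 0 := by
  have hc : Continuous fun x => besselJ0 (a * x) := continuous_besselJ0.comp (by fun_prop)
  have hb : ∀ x, |besselJ0 (a * x)| ≤ 1 := fun x => abs_besselJ0_le_one _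
  obtain ⟨i1, d1⟩ := hasDerivAt_integral_cexp_mul hc hb hp
  have i0 := integrableOn_cexp_mul hc hb hp
  refine ⟨_, d1, ?_⟩
  rw [besselLaplace, ← integral_const_mul, ← integral_const_mul,
    ← integral_add (i1.const_mul _) (i0.const_mul _)]
  have hd : ∀ x ∈ Set.Ici (0 : ℝ), HasDerivAt
      (fun x : ℝ => Complex.exp (-(p * x)) * (x * ((a * besselJ0Deriv (a * x) : ℝ)
        + p * (besselJ0 (a * x) : ℝ))))
      ((p ^ 2 + (a : ℂ) ^ 2) * -(x * (Complex.exp (-(p * x)) * (besselJ0 (a * x) : ℂ)))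
        + p * (Complex.exp (-(p * x)) * (besselJ0 (a * x) : ℂ))) x := by
    intro x _
    have hax := (hasDerivAt_id' x).const_mul a
    have dy := ((hasDerivAt_besselJ0 (a * x)).comp x hax).ofReal_comp
    have dy' := (((hasDerivAt_besselJ0Deriv (a * x)).comp x hax).const_mul a).ofReal_comp
    have dx := (hasDerivAt_id' x).ofReal_comp
    have h := ((dx.const_mul p).neg.cexp).mul (dx.mul (dy'.add (dy.const_mul p)))
    refine h.congr_deriv ?_
    have ode : ((a * x : ℝ) : ℂ) * besselJ0Deriv2 (a * x) + besselJ0Deriv (a * x)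
        + (a * x : ℝ) * besselJ0 (a * x) = 0 := by
      exact_mod_cast congrArg (fun r : ℝ => (r : ℂ)) (bessel_equation (a * x))
    push_cast at ode ⊢
    simp only [Pi.add_apply, Function.comp_apply, Pi.mul_apply]
    linear_combination (Complex.exp (-(p * x)) * a) * ode
  have ht : Tendsto (fun x : ℝ => Complex.exp (-(p * x)) * (x * ((a * besselJ0Deriv (a * x) : ℝ)
        + p * (besselJ0 (a * x) : ℝ)))) atTop (𝓝 0) := by
    have h0 : Tendsto (fun x : ℝ => x * Real.exp (-(p.re * x)) * (|a| + ‖p‖)) atTop (𝓝 0) := by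
      simpa using (tendsto_rpow_mul_exp_neg_mul_atTop_nhds_zero 1 p.re hp).mul_const (|a| + ‖p‖)
    refine squeeze_zero_norm' ?_ h0
    filter_upwards [eventually_ge_atTop 0] with x hx
    rw [norm_mul, norm_mul, norm_cexp_neg_mul, Complex.norm_real, Real.norm_of_nonneg hx]
    have h1 : ‖((a * besselJ0Deriv (a * x) : ℝ) : ℂ) + p * (besselJ0 (a * x) : ℝ)‖
        ≤ |a| + ‖p‖ := by
      refine (norm_add_le _ _).trans (add_le_add ?_ ?_)
      · rw [Complex.norm_real, norm_mul]
        exact mul_le_of_le_one_right (abs_nonneg _) (abs_besselJ0Deriv_le_one _)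
      · rw [norm_mul, Complex.norm_real]
        exact mul_le_of_le_one_right (norm_nonneg _) (hb x)
    calc _ = x * Real.exp (-(p.re * x)) * _ := by ring
      _ ≤ _ := mul_le_mul_of_nonneg_left h1 (by positivity)
  rw [integral_Ioi_of_hasDerivAt_of_tendsto' hd ((i1.const_mul _).add (i0.const_mul _)) ht]
  simp

lemma sq_add_sq_mem_slitPlane {a : ℝ} (ha : 0 < a) {p : ℂ} (hp : 0 < p.re) :
    p ^ 2 + (a : ℂ) ^ 2 ∈ Complex.slitPlane := by
  rw [Complex.mem_slitPlane_iff]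
  simp only [Complex.add_re, Complex.add_im, sq, Complex.mul_re, Complex.mul_im, Complex.ofReal_re,
    Complex.ofReal_im, mul_zero, sub_zero, zero_mul, add_zero]
  rcases eq_or_ne p.im 0 with h | h
  · left; rw [h]; nlinarith
  · right
    have : p.re * p.im ≠ 0 := mul_ne_zero hp.ne' h
    intro h0; apply this; linarith

lemma besselLaplace_ofReal (a ε : ℝ) : besselLaplace a ε
    = ((∫ x in Set.Ioi (0 : ℝ), Real.exp (-(ε * x)) * besselJ0 (a * x) : ℝ) : ℂ) := by
  rw [besselLaplace, ← integral_complex_ofReal]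
  simp

/-- The Laplace transform of `J₀(ax)` is `(p² + a²)^(-1/2)` on the right half-plane. -/
lemma besselLaplace_eq {a : ℝ} (ha : 0 < a) {p : ℂ} (hp : 0 < p.re) :
    besselLaplace a p = (p ^ 2 + (a : ℂ) ^ 2) ^ (-1 / 2 : ℂ) := by
  let K : ℂ → ℂ := fun p => (p ^ 2 + (a : ℂ) ^ 2) ^ (1 / 2 : ℂ) * besselLaplace a p
  have hd : ∀ q : ℂ, 0 < q.re → HasDerivAt K 0 q := by
    intro q hq
    obtain ⟨G', h1, h2⟩ := hasDerivAt_besselLaplace a hq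
    have hs := sq_add_sq_mem_slitPlane ha hq
    have hne := Complex.slitPlane_ne_zero hs
    have h3 := ((((hasDerivAt_id' q).pow 2).add_const ((a : ℂ) ^ 2)).cpow_const (c := 1 / 2) hs).mul
      h1
    refine h3.congr_deriv ?_
    have e : (q ^ 2 + (a : ℂ) ^ 2) ^ (1 / 2 : ℂ)
        = (q ^ 2 + (a : ℂ) ^ 2) ^ (1 / 2 - 1 : ℂ) * (q ^ 2 + (a : ℂ) ^ 2) := by
      rw [Complex.cpow_sub _ _ hne, Complex.cpow_one]; field_simp
    simp only [Pi.pow_apply]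
    rw [e]
    push_cast
    linear_combination (q ^ 2 + (a : ℂ) ^ 2) ^ (1 / 2 - 1 : ℂ) * h2
  have hconst : ∀ n : ℝ, 0 < n → K p = K (n : ℂ) := by
    intro n hn
    have hconv : Convex ℝ {q : ℂ | 0 < q.re} := convex_halfSpace_re_gt 0
    refine (isOpen_lt continuous_const Complex.continuous_re).is_const_of_deriv_eq_zero
      (s := {q : ℂ | 0 < q.re}) hconv.isPreconnected
      (fun q hq => (hd q hq).differentiableAt.differentiableWithinAt)
      (fun q hq => (hd q hq).deriv) hp ?_
    simpa using hn
  have hreal : ∀ n : ℝ, 0 < n → K (n : ℂ) = ((√(1 + (a / n) ^ 2)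
      * (n * ∫ x in Set.Ioi (0 : ℝ), Real.exp (-(n * x)) * besselJ0 (a * x)) : ℝ) : ℂ) := by
    intro n hn
    have e : (((n ^ 2 + a ^ 2 : ℝ) : ℂ)) ^ ((1 / 2 : ℝ) : ℂ) = ((√(1 + (a / n) ^ 2) * n : ℝ) : ℂ) := by
      rw [← Complex.ofReal_cpow (by positivity), ← Real.sqrt_eq_rpow]
      congr 1
      rw [show n ^ 2 + a ^ 2 = (1 + (a / n) ^ 2) * n ^ 2 by field_simp,
        Real.sqrt_mul (by positivity), Real.sqrt_sq hn.le]
    simp only [K]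
    rw [besselLaplace_ofReal, ← mul_assoc, Complex.ofReal_mul, ← e]
    push_cast
    rfl
  have hlim : Tendsto (fun n : ℝ => ((√(1 + (a / n) ^ 2)
      * (n * ∫ x in Set.Ioi (0 : ℝ), Real.exp (-(n * x)) * besselJ0 (a * x)) : ℝ) : ℂ)) atTop
      (𝓝 ((√(1 + 0 ^ 2) * 1 : ℝ) : ℂ)) := by
    refine (Complex.continuous_ofReal.tendsto _).comp ?_
    have h0 : Tendsto (fun n : ℝ => a / n) atTop (𝓝 0) := tendsto_id.const_div_atTop a
    refine ((Real.continuous_sqrt.tendsto _).comp (tendsto_const_nhds.add (h0.pow 2))).mul ?_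
    refine tendsto_mul_integral_exp_mul (g := fun x => besselJ0 (a * x)) (C := 1)
      (continuous_besselJ0.comp (by fun_prop)) (fun x => abs_besselJ0_le_one _)
      (eventually_gt_atTop 0) fun u _ => ?_
    have h1 : Tendsto (fun n : ℝ => a * (u / n)) atTop (𝓝 0) := by
      simpa using (tendsto_id.const_div_atTop u).const_mul a
    have h2 := (continuous_besselJ0.tendsto 0).comp h1
    rwa [besselJ0_zero] at h2
  have hK : K p = 1 := by
    refine tendsto_nhds_unique (tendsto_const_nhds.congr' ?_) (by simpa using hlim)
    filter_upwards [eventually_gt_atTop 0] with n hn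
    rw [hconst n hn, hreal n hn]
    push_cast
    rfl
  have hne := Complex.slitPlane_ne_zero (sq_add_sq_mem_slitPlane ha hp)
  rw [show (-1 / 2 : ℂ) = -(1 / 2) by ring, Complex.cpow_neg]
  exact eq_inv_of_mul_eq_one_right hK

lemma integral_exp_mul_besselJ0_mul_cos {a : ℝ} (ha : 0 < a) (c : ℝ) {ε : ℝ} (hε : 0 < ε) :
    ∫ x in Set.Ioi (0 : ℝ), Real.exp (-(ε * x)) * (besselJ0 (a * x) * Real.cos (c * x))
      = ((((ε : ℂ) + c * Complex.I) ^ 2 + (a : ℂ) ^ 2) ^ (-1 / 2 : ℂ)).re := by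
  have hp : 0 < ((ε : ℂ) + c * Complex.I).re := by simpa using hε
  have hi := integrableOn_cexp_mul (g := fun x => besselJ0 (a * x)) (C := 1)
      (continuous_besselJ0.comp (by fun_prop)) (fun x => abs_besselJ0_le_one _) hp
  rw [← besselLaplace_eq ha hp, besselLaplace]
  have := Complex.reCLM.integral_comp_comm hi
  simp only [Complex.reCLM_apply] at this
  rw [← this]
  refine integral_congr_ae (ae_of_all _ fun x => ?_)
  simp only [Complex.re_mul_ofReal, Complex.exp_re]
  simp
  ring

/-- A bound, uniform in `ε`, that makes dominated convergence in the frequency `c` possible. -/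
lemma abs_integral_exp_mul_besselJ0_mul_cos_le {a c ρ : ℝ} (ha : 0 < a) (hρ : ρ < a)
    (hc : |c| ≤ ρ) {ε : ℝ} (hε : 0 < ε) :
    |∫ x in Set.Ioi (0 : ℝ), Real.exp (-(ε * x)) * (besselJ0 (a * x) * Real.cos (c * x))|
      ≤ (a ^ 2 - ρ ^ 2) ^ (-1 / 2 : ℝ) := by
  rw [integral_exp_mul_besselJ0_mul_cos ha c hε]
  refine (Complex.abs_re_le_norm _).trans ?_
  have e : (-1 / 2 : ℂ) = ((-1 / 2 : ℝ) : ℂ) := by push_cast; ring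
  rw [e, Complex.norm_cpow_real]
  have hc2 : c ^ 2 ≤ ρ ^ 2 := sq_le_sq' (by linarith [neg_abs_le c]) ((le_abs_self c).trans hc)
  have hρ0 : 0 ≤ ρ := (abs_nonneg c).trans hc
  refine Real.rpow_le_rpow_of_nonpos (by nlinarith) ?_ (by norm_num)
  refine le_trans ?_ (Complex.re_le_norm _)
  simp only [Complex.add_re, sq, Complex.mul_re, Complex.ofReal_re,
    Complex.ofReal_im, Complex.add_im, Complex.mul_im, Complex.I_re, Complex.I_im]
  nlinarith

lemma tendsto_integral_exp_mul_besselJ0_mul_cos {a c : ℝ} (ha : 0 < a) (hc : |c| < a) :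
    Tendsto (fun ε => ∫ x in Set.Ioi (0 : ℝ),
      Real.exp (-(ε * x)) * (besselJ0 (a * x) * Real.cos (c * x))) (𝓝[>] 0)
      (𝓝 ((a ^ 2 - c ^ 2) ^ (-1 / 2 : ℝ))) := by
  have hpos : 0 < a ^ 2 - c ^ 2 := by
    have := sq_lt_sq' (by linarith [neg_abs_le c]) ((le_abs_self c).trans_lt hc); linarith
  have e : (((0 : ℝ) : ℂ) + c * Complex.I) ^ 2 + (a : ℂ) ^ 2 = ((a ^ 2 - c ^ 2 : ℝ) : ℂ) := by
    push_cast; rw [zero_add, mul_pow, Complex.I_sq]; ring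
  have hcont : ContinuousAt (fun ε : ℝ =>
      ((((ε : ℂ) + c * Complex.I) ^ 2 + (a : ℂ) ^ 2) ^ (-1 / 2 : ℂ)).re) 0 := by
    refine Complex.continuous_re.continuousAt.comp ?_
    refine ContinuousAt.cpow (Continuous.continuousAt (by fun_prop)) continuousAt_const ?_
    rw [e]
    exact Complex.ofReal_mem_slitPlane.2 hpos
  have h := hcont.tendsto.mono_left (nhdsWithin_le_nhds (s := Set.Ioi 0))
  rw [e, show (-1 / 2 : ℂ) = ((-1 / 2 : ℝ) : ℂ) by push_cast; ring,
    ← Complex.ofReal_cpow hpos.le, Complex.ofReal_re] at h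
  refine h.congr' ?_
  filter_upwards [self_mem_nhdsWithin] with ε hε
  rw [integral_exp_mul_besselJ0_mul_cos ha c hε]
  push_cast
  rfl

/-! ### Products of two Bessel functions as cosine transforms -/

lemma abs_le_one_ae_arcsineMeasure_prod :
    ∀ᵐ z ∂arcsineMeasure.prod arcsineMeasure, |z.1| ≤ 1 ∧ |z.2| ≤ 1 :=
  (Measure.quasiMeasurePreserving_fst.ae abs_le_one_ae_arcsineMeasure).and
    (Measure.quasiMeasurePreserving_snd.ae abs_le_one_ae_arcsineMeasure)

lemma integrable_arcsineMeasure_prod {f : ℝ × ℝ → ℝ} (hf : Continuous f) :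
    Integrable f (arcsineMeasure.prod arcsineMeasure) := by
  obtain ⟨C, hC⟩ := ((isCompact_Icc (a := (-1 : ℝ)) (b := 1)).prod
    (isCompact_Icc (a := (-1 : ℝ)) (b := 1))).exists_bound_of_continuousOn hf.continuousOn
  refine Integrable.of_bound hf.aestronglyMeasurable C ?_
  filter_upwards [abs_le_one_ae_arcsineMeasure_prod] with z hz
  exact hC z ⟨abs_le.1 hz.1, abs_le.1 hz.2⟩

lemma abs_frequency_le (a₁ a₂ : ℝ) {z : ℝ × ℝ} (hz : |z.1| ≤ 1 ∧ |z.2| ≤ 1) :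
    |a₁ * z.1 + a₂ * z.2| ≤ |a₁| + |a₂| := by
  refine (abs_add_le _ _).trans (add_le_add ?_ ?_)
  · rw [abs_mul]; exact mul_le_of_le_one_right (abs_nonneg _) hz.1
  · rw [abs_mul]; exact mul_le_of_le_one_right (abs_nonneg _) hz.2

lemma besselJ0_mul_besselJ0_eq_integral (a₁ a₂ x : ℝ) :
    besselJ0 (a₁ * x) * besselJ0 (a₂ * x)
      = ∫ z, Real.cos ((a₁ * z.1 + a₂ * z.2) * x) ∂arcsineMeasure.prod arcsineMeasure := by
  have e : ∀ z : ℝ × ℝ, Real.cos ((a₁ * z.1 + a₂ * z.2) * x)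
      = Real.cos (a₁ * x * z.1) * Real.cos (a₂ * x * z.2)
        - Real.sin (a₁ * x * z.1) * Real.sin (a₂ * x * z.2) := fun z => by
    rw [← Real.cos_add]; ring_nf
  simp only [e]
  rw [integral_sub (integrable_arcsineMeasure_prod (by fun_prop))
    (integrable_arcsineMeasure_prod (by fun_prop)),
    integral_prod_mul (fun t => Real.cos (a₁ * x * t)) (fun t => Real.cos (a₂ * x * t)),
    integral_prod_mul (fun t => Real.sin (a₁ * x * t)) (fun t => Real.sin (a₂ * x * t)),
    integral_sin_mul_arcsineMeasure, zero_mul, sub_zero, besselJ0_eq_integral,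
    besselJ0_eq_integral]

/-- The even moments of the frequency `a₁ t₁ + a₂ t₂`, where `t₁`, `t₂` are independent with the
arcsine law, are the polynomials `l_s` up to normalization. -/
lemma integral_frequency_pow (a₁ a₂ : ℝ) (s : ℕ) :
    ∫ z, (a₁ * z.1 + a₂ * z.2) ^ (2 * s) ∂arcsineMeasure.prod arcsineMeasure
      = wallisCoeff s * ((s ! : ℝ) * prodPoly s (a₁ ^ 2) (a₂ ^ 2)) := by
  have e : ∀ z : ℝ × ℝ, (a₁ * z.1 + a₂ * z.2) ^ (2 * s) = ∑ m ∈ Finset.range (2 * s + 1),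
      (a₂ ^ m * a₁ ^ (2 * s - m) * ((2 * s).choose m : ℝ)) * (z.1 ^ (2 * s - m) * z.2 ^ m) :=
    fun z => by
      rw [add_comm, add_pow]
      refine Finset.sum_congr rfl fun m _ => ?_
      rw [mul_pow, mul_pow]
      ring
  simp only [e]
  rw [integral_finsetSum _ fun m _ => integrable_arcsineMeasure_prod (by fun_prop), prodPoly,
    Finset.mul_sum, Finset.mul_sum, Finset.mul_sum]
  symm
  refine Finset.sum_of_injOn (fun k => 2 * k) (fun i _ j _ h => by simpa using h)
    (fun k hk => by simp at hk ⊢; omega) ?_ ?_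
  · intro m _ hm
    rw [integral_const_mul, integral_prod_mul (fun t : ℝ => t ^ (2 * s - m)) (fun t : ℝ => t ^ m)]
    rcases Nat.even_or_odd' m with ⟨k, rfl | rfl⟩
    · exact absurd ⟨k, by simp_all, rfl⟩ hm
    · rw [integral_pow_odd_arcsineMeasure, mul_zero, mul_zero]
  · intro k hk
    obtain ⟨t, rfl⟩ := Nat.exists_eq_add_of_le (Finset.mem_range_succ_iff.1 hk)
    rw [integral_const_mul, integral_prod_mul (fun u : ℝ => u ^ (2 * (k + t) - 2 * k))
      (fun u : ℝ => u ^ (2 * k)), Nat.cast_choose ℝ (by omega : 2 * k ≤ 2 * (k + t)),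
      show 2 * (k + t) - 2 * k = 2 * t by omega, Nat.add_sub_cancel_left,
      integral_pow_even_arcsineMeasure, integral_pow_even_arcsineMeasure]
    simp only [wallisCoeff]
    have h1 : (k ! : ℝ) ≠ 0 := by positivity
    have h2 : (t ! : ℝ) ≠ 0 := by positivity
    have h3 : ((k + t)! : ℝ) ≠ 0 := by positivity
    have h4 : ((2 * k)! : ℝ) ≠ 0 := by positivity
    have h5 : ((2 * t)! : ℝ) ≠ 0 := by positivity
    simp only [mul_add, pow_add, pow_mul]
    field_simp

/-! ### The Abel mean of the triple product -/

/-- Fubini turns the Laplace transform of the triple product into the mean over the frequency of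
a Laplace transform known in closed form. -/
lemma tendsto_integral_exp_mul_triple {a₁ a₂ a₃ : ℝ} (h : |a₁| + |a₂| < a₃) :
    Tendsto (fun ε => ∫ x in Set.Ioi (0 : ℝ), Real.exp (-(ε * x)) *
        (besselJ0 (a₁ * x) * besselJ0 (a₂ * x) * besselJ0 (a₃ * x))) (𝓝[>] 0)
      (𝓝 (∫ z, (a₃ ^ 2 - (a₁ * z.1 + a₂ * z.2) ^ 2) ^ (-1 / 2 : ℝ)
        ∂arcsineMeasure.prod arcsineMeasure)) := by
  have ha : 0 < a₃ := lt_of_le_of_lt (by positivity) h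
  have key : ∀ ε : ℝ, 0 < ε → ∫ z, (∫ x in Set.Ioi (0 : ℝ), Real.exp (-(ε * x)) *
      (besselJ0 (a₃ * x) * Real.cos ((a₁ * z.1 + a₂ * z.2) * x)))
        ∂arcsineMeasure.prod arcsineMeasure
      = ∫ x in Set.Ioi (0 : ℝ), Real.exp (-(ε * x)) *
        (besselJ0 (a₁ * x) * besselJ0 (a₂ * x) * besselJ0 (a₃ * x)) := by
    intro ε hε
    rw [integral_integral_swap]
    · refine integral_congr_ae (ae_of_all _ fun x => ?_)
      simp only
      rw [integral_const_mul, integral_const_mul, besselJ0_mul_besselJ0_eq_integral]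
      ring
    · have hi : Integrable (fun q : (ℝ × ℝ) × ℝ => (1 : ℝ) * Real.exp (-ε * q.2))
          ((arcsineMeasure.prod arcsineMeasure).prod (volume.restrict (Set.Ioi 0))) :=
        (integrable_const (1 : ℝ)).mul_prod (exp_neg_integrableOn_Ioi 0 hε)
      refine hi.mono' (Continuous.aestronglyMeasurable ?_) (ae_of_all _ fun q => ?_)
      · have := continuous_besselJ0
        simp only [Function.uncurry_def]
        fun_prop
      · rw [Function.uncurry_apply_pair, norm_mul, norm_mul, Real.norm_of_nonneg (Real.exp_pos _).le,
          one_mul, neg_mul]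
        exact mul_le_of_le_one_right (Real.exp_pos _).le (mul_le_one₀ (abs_besselJ0_le_one _)
          (norm_nonneg _) (Real.abs_cos_le_one _))
  have hlim := tendsto_integral_filter_of_dominated_convergence
    (μ := arcsineMeasure.prod arcsineMeasure) (l := 𝓝[>] (0 : ℝ))
    (F := fun ε z => ∫ x in Set.Ioi (0 : ℝ), Real.exp (-(ε * x)) *
      (besselJ0 (a₃ * x) * Real.cos ((a₁ * z.1 + a₂ * z.2) * x)))
    (f := fun z => (a₃ ^ 2 - (a₁ * z.1 + a₂ * z.2) ^ 2) ^ (-1 / 2 : ℝ))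
    (fun _ => (a₃ ^ 2 - (|a₁| + |a₂|) ^ 2) ^ (-1 / 2 : ℝ))
    (Eventually.of_forall fun ε => ?_) ?_ (integrable_const _) ?_
  · refine hlim.congr' ?_
    filter_upwards [self_mem_nhdsWithin] with ε hε using key ε hε
  · refine StronglyMeasurable.aestronglyMeasurable ?_
    refine StronglyMeasurable.integral_prod_right' (f := fun q : (ℝ × ℝ) × ℝ =>
      Real.exp (-(ε * q.2)) * (besselJ0 (a₃ * q.2) *
        Real.cos ((a₁ * q.1.1 + a₂ * q.1.2) * q.2))) (Continuous.stronglyMeasurable ?_)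
    have := continuous_besselJ0
    fun_prop
  · filter_upwards [self_mem_nhdsWithin] with ε hε
    filter_upwards [abs_le_one_ae_arcsineMeasure_prod] with z hz
    exact abs_integral_exp_mul_besselJ0_mul_cos_le ha h (abs_frequency_le a₁ a₂ hz) hε
  · filter_upwards [abs_le_one_ae_arcsineMeasure_prod] with z hz
    exact tendsto_integral_exp_mul_besselJ0_mul_cos ha ((abs_frequency_le a₁ a₂ hz).trans_lt h)

lemma hasSum_rpow_neg_half_sub {a c : ℝ} (ha : 0 < a) (hc : |c| < a) :
    HasSum (fun s : ℕ => a⁻¹ * (wallisCoeff s * c ^ (2 * s) / (a ^ 2) ^ s))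
      ((a ^ 2 - c ^ 2) ^ (-1 / 2 : ℝ)) := by
  have h1 : (c / a) ^ 2 < 1 := by
    rw [sq_lt_one_iff_abs_lt_one, abs_div, abs_of_pos ha, div_lt_one ha]; exact hc
  have h2 := (hasSum_wallisCoeff_mul_pow (z := (c / a) ^ 2)
    (by rwa [abs_of_nonneg (sq_nonneg _)])).mul_left a⁻¹
  convert! h2 using 1
  · funext s
    rw [div_pow, div_pow (c ^ 2), ← pow_mul c, mul_div_assoc]
  · rw [show a ^ 2 - c ^ 2 = a ^ 2 * (1 - (c / a) ^ 2) by field_simp,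
      Real.mul_rpow (by positivity) (by linarith), ← Real.rpow_natCast, ← Real.rpow_mul ha.le]
    norm_num [Real.rpow_neg_one]

lemma hasSum_wallisCoeff_sq_mul_prodPoly {a₁ a₂ a₃ : ℝ} (h : |a₁| + |a₂| < a₃) :
    HasSum (fun s : ℕ => wallisCoeff s ^ 2 * ((s ! : ℝ) * prodPoly s (a₁ ^ 2) (a₂ ^ 2)
        / (a₃ ^ 2) ^ s))
      (a₃ * ∫ z, (a₃ ^ 2 - (a₁ * z.1 + a₂ * z.2) ^ 2) ^ (-1 / 2 : ℝ)
        ∂arcsineMeasure.prod arcsineMeasure) := by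
  have ha : 0 < a₃ := lt_of_le_of_lt (by positivity) h
  have hsum := hasSum_integral_of_dominated_convergence (μ := arcsineMeasure.prod arcsineMeasure)
    (F := fun s z => a₃⁻¹ * (wallisCoeff s * (a₁ * z.1 + a₂ * z.2) ^ (2 * s) / (a₃ ^ 2) ^ s))
    (f := fun z => (a₃ ^ 2 - (a₁ * z.1 + a₂ * z.2) ^ 2) ^ (-1 / 2 : ℝ))
    (fun s _ => a₃⁻¹ * (wallisCoeff s * (|a₁| + |a₂|) ^ (2 * s) / (a₃ ^ 2) ^ s))
    (fun s => Continuous.aestronglyMeasurable (by fun_prop)) (fun s => ?_)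
    (ae_of_all _ fun _ => (hasSum_rpow_neg_half_sub ha
      (by rwa [abs_of_nonneg (by positivity)])).summable) (integrable_const _) ?_
  · convert! hsum.mul_left a₃ using 2 with s
    have e : ∀ z : ℝ × ℝ, a₃⁻¹ * (wallisCoeff s * (a₁ * z.1 + a₂ * z.2) ^ (2 * s) / (a₃ ^ 2) ^ s)
        = (a₃⁻¹ * wallisCoeff s / (a₃ ^ 2) ^ s) * (a₁ * z.1 + a₂ * z.2) ^ (2 * s) := fun z => by
      ring
    simp only [e]
    rw [integral_const_mul, integral_frequency_pow]
    field_simp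
  · filter_upwards [abs_le_one_ae_arcsineMeasure_prod] with z hz
    have hw := wallisCoeff_pos s
    rw [norm_mul, norm_div, norm_mul, norm_pow, Real.norm_of_nonneg (by positivity),
      Real.norm_of_nonneg hw.le, Real.norm_of_nonneg (r := (a₃ ^ 2) ^ s) (by positivity)]
    have := abs_frequency_le a₁ a₂ hz
    rw [Real.norm_eq_abs]
    gcongr
  · filter_upwards [abs_le_one_ae_arcsineMeasure_prod] with z hz
    exact hasSum_rpow_neg_half_sub ha ((abs_frequency_le a₁ a₂ hz).trans_lt h)

/-! ### Convergence of the improper integrals -/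

lemma abs_besselJ0_mul_le {α a x : ℝ} (hα : 0 < α) (ha : α ≤ |a|) (hx : 0 < x) :
    |besselJ0 (a * x)| ≤ √(1 + 7 / α) * (1 + x) ^ (-1 / 2 : ℝ) := by
  have ha0 : 0 < |a| := hα.trans_le ha
  have h1 := besselJ0_sq_add_deriv_sq_le (mul_pos ha0 hx)
  rw [besselJ0_abs_mul] at h1
  have h2 : besselJ0 (a * x) ^ 2 * x ≤ 7 / α := by
    have h3 : besselJ0 (a * x) ^ 2 ≤ 7 / (|a| * x) := by
      nlinarith [sq_nonneg (besselJ0Deriv (|a| * x))]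
    calc besselJ0 (a * x) ^ 2 * x ≤ 7 / (|a| * x) * x := by gcongr
      _ = 7 / |a| := by field_simp
      _ ≤ 7 / α := by gcongr
  have h4 : besselJ0 (a * x) ^ 2 ≤ 1 := (sq_le_one_iff_abs_le_one _).2 (abs_besselJ0_le_one _)
  refine abs_le_of_sq_le_sq ?_ (by positivity)
  have e : ((1 + x) ^ (-1 / 2 : ℝ)) ^ 2 = (1 + x)⁻¹ := by
    rw [← Real.rpow_natCast, ← Real.rpow_mul (by positivity)]
    norm_num [Real.rpow_neg_one]
  rw [mul_pow, Real.sq_sqrt (by positivity), e, ← div_eq_mul_inv, le_div_iff₀ (by positivity)]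
  linarith

/-- A majorant of the triple product, uniform as long as the three frequencies stay away from
zero. -/
lemma abs_triple_le {α a₁ a₂ a₃ x : ℝ} (hα : 0 < α) (h₁ : α ≤ |a₁|) (h₂ : α ≤ |a₂|)
    (h₃ : α ≤ |a₃|) (hx : 0 < x) :
    |besselJ0 (a₁ * x) * besselJ0 (a₂ * x) * besselJ0 (a₃ * x)|
      ≤ √(1 + 7 / α) ^ 3 * (1 + ‖x‖) ^ (-(3 / 2) : ℝ) := by
  have e : (1 + ‖x‖) ^ (-(3 / 2) : ℝ) = ((1 + x) ^ (-1 / 2 : ℝ)) ^ 3 := by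
    rw [Real.norm_of_nonneg hx.le, ← Real.rpow_natCast, ← Real.rpow_mul (by positivity)]
    norm_num
  rw [e, ← mul_pow, abs_mul, abs_mul, pow_succ, pow_two]
  gcongr
  exacts [abs_besselJ0_mul_le hα h₁ hx, abs_besselJ0_mul_le hα h₂ hx,
    abs_besselJ0_mul_le hα h₃ hx]

lemma integrable_one_add_norm_rpow (K : ℝ) :
    Integrable (fun x : ℝ => K * (1 + ‖x‖) ^ (-(3 / 2) : ℝ)) :=
  (integrable_one_add_norm (by simp; norm_num)).const_mul K

lemma continuous_triple (a₁ a₂ a₃ : ℝ) :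
    Continuous fun x => besselJ0 (a₁ * x) * besselJ0 (a₂ * x) * besselJ0 (a₃ * x) := by
  have := continuous_besselJ0
  fun_prop

lemma abs_triple_le_one (a₁ a₂ a₃ x : ℝ) :
    |besselJ0 (a₁ * x) * besselJ0 (a₂ * x) * besselJ0 (a₃ * x)| ≤ 1 := by
  rw [abs_mul, abs_mul]
  exact mul_le_one₀ (mul_le_one₀ (abs_besselJ0_le_one _) (abs_nonneg _) (abs_besselJ0_le_one _))
    (abs_nonneg _) (abs_besselJ0_le_one _)

lemma exists_pos_le_abs {a₁ a₂ a₃ : ℝ} (h₁ : a₁ ≠ 0) (h₂ : a₂ ≠ 0) (h₃ : a₃ ≠ 0) :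
    ∃ α, 0 < α ∧ α ≤ |a₁| ∧ α ≤ |a₂| ∧ α ≤ |a₃| :=
  ⟨min |a₁| (min |a₂| |a₃|), by simp [h₁, h₂, h₃], min_le_left _ _,
    (min_le_right _ _).trans (min_le_left _ _), (min_le_right _ _).trans (min_le_right _ _)⟩

lemma integrableOn_triple {a₁ a₂ a₃ : ℝ} (h₁ : a₁ ≠ 0) (h₂ : a₂ ≠ 0) (h₃ : a₃ ≠ 0) :
    IntegrableOn (fun x => besselJ0 (a₁ * x) * besselJ0 (a₂ * x) * besselJ0 (a₃ * x))
      (Set.Ioi 0) := by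
  obtain ⟨α, hα, k₁, k₂, k₃⟩ := exists_pos_le_abs h₁ h₂ h₃
  refine (integrable_one_add_norm_rpow (√(1 + 7 / α) ^ 3)).integrableOn.mono'
    (continuous_triple a₁ a₂ a₃).aestronglyMeasurable ?_
  filter_upwards [ae_restrict_mem measurableSet_Ioi] with x hx
  exact abs_triple_le hα k₁ k₂ k₃ hx

/-- Conditional convergence of `∫ J₀(ax) J₀(bx)`. For `V = a J₀'(ax) J₀(bx) - b J₀(ax) J₀'(bx)`,
Bessel's equation gives `V' = (b² - a²) J₀(ax) J₀(bx) - V / x`, and `V = O(x^(-1/2))`. -/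
lemma exists_tendsto_integral_besselJ0_mul {a b : ℝ} (ha : 0 < a) (hb : |b| < a) :
    ∃ L, Tendsto (fun R => ∫ x in (0 : ℝ)..R, besselJ0 (a * x) * besselJ0 (b * x)) atTop
      (𝓝 L) := by
  have hc0 := continuous_besselJ0
  have hc1 := continuous_besselJ0Deriv
  let V : ℝ → ℝ := fun x =>
    a * besselJ0Deriv (a * x) * besselJ0 (b * x) - b * (besselJ0 (a * x) * besselJ0Deriv (b * x))
  have hVc : Continuous V := by fun_prop
  have hV : ∀ x, 0 < x → HasDerivAt V
      ((b ^ 2 - a ^ 2) * (besselJ0 (a * x) * besselJ0 (b * x)) - V x / x) x := by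
    intro x hx
    have la := (hasDerivAt_id' x).const_mul a
    have lb := (hasDerivAt_id' x).const_mul b
    have h := ((((hasDerivAt_besselJ0Deriv (a * x)).comp x la).const_mul a).mul
      ((hasDerivAt_besselJ0 (b * x)).comp x lb)).sub
      ((((hasDerivAt_besselJ0 (a * x)).comp x la).mul
        ((hasDerivAt_besselJ0Deriv (b * x)).comp x lb)).const_mul b)
    refine h.congr_deriv ?_
    have oa := bessel_equation (a * x)
    have ob := bessel_equation (b * x)
    simp only [Function.comp_apply, V]
    generalize besselJ0 (a * x) = ya at oa ⊢
    generalize besselJ0 (b * x) = yb at ob ⊢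
    generalize besselJ0Deriv (a * x) = ya' at oa ⊢
    generalize besselJ0Deriv (b * x) = yb' at ob ⊢
    generalize besselJ0Deriv2 (a * x) = ya'' at oa ⊢
    generalize besselJ0Deriv2 (b * x) = yb'' at ob ⊢
    field_simp
    linear_combination a * yb * oa - b * ya * ob
  have hVb : ∀ x, 0 < x → |V x| ≤ (a + |b|) * (3 / √a) * x ^ (-(1 / 2) : ℝ) := by
    intro x hx
    have hs : 3 / √(a * x) = 3 / √a * x ^ (-(1 / 2) : ℝ) := by
      rw [Real.sqrt_mul ha.le, Real.rpow_neg hx.le, ← Real.sqrt_eq_rpow]; field_simp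
    rw [mul_assoc, ← hs, add_mul]
    refine (abs_sub _ _).trans (add_le_add ?_ ?_)
    · rw [abs_mul, abs_mul, abs_of_pos ha, mul_assoc]
      refine mul_le_mul_of_nonneg_left ?_ ha.le
      exact (mul_le_of_le_one_right (abs_nonneg _) (abs_besselJ0_le_one _)).trans
        (abs_besselJ0Deriv_le (mul_pos ha hx))
    · rw [abs_mul, abs_mul]
      refine mul_le_mul_of_nonneg_left ?_ (abs_nonneg _)
      exact (mul_le_of_le_one_right (abs_nonneg _) (abs_besselJ0Deriv_le_one _)).trans
        (abs_besselJ0_le (mul_pos ha hx))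
  have hVlim : Tendsto V atTop (𝓝 0) := by
    have h0 := (tendsto_rpow_neg_atTop (y := (1 / 2 : ℝ)) (by norm_num)).const_mul
      ((a + |b|) * (3 / √a))
    rw [mul_zero] at h0
    refine squeeze_zero_norm' ?_ h0
    filter_upwards [eventually_gt_atTop 0] with x hx using hVb x hx
  have hVi : IntegrableOn (fun x => V x / x) (Set.Ioi 1) := by
    refine ((integrableOn_Ioi_rpow_of_lt (a := -(3 / 2 : ℝ)) (by norm_num) one_pos).const_mul
      ((a + |b|) * (3 / √a))).mono' (hVc.measurable.div measurable_id).aestronglyMeasurable ?_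
    filter_upwards [ae_restrict_mem measurableSet_Ioi] with x hx
    have hx : 0 < x := one_pos.trans hx
    rw [norm_div, Real.norm_of_nonneg hx.le, div_le_iff₀ hx, mul_assoc, ← Real.rpow_add_one hx.ne']
    have := hVb x hx
    norm_num at this ⊢
    exact this
  have hab : b ^ 2 - a ^ 2 ≠ 0 := by
    have := sq_lt_sq' (by linarith [neg_abs_le b]) ((le_abs_self b).trans_lt hb); linarith
  have hfc : Continuous fun x => besselJ0 (a * x) * besselJ0 (b * x) := by fun_prop
  refine ⟨_, Tendsto.congr' ?_ (((hVlim.sub_const (V 1)).add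
    (intervalIntegral_tendsto_integral_Ioi 1 hVi tendsto_id)).div_const
      (b ^ 2 - a ^ 2) |>.const_add (∫ x in (0 : ℝ)..1, besselJ0 (a * x) * besselJ0 (b * x)))⟩
  filter_upwards [eventually_ge_atTop 1] with R hR
  have hpos : ∀ x ∈ Set.uIcc 1 R, 0 < x := fun x hx => by
    rw [Set.uIcc_of_le hR] at hx; exact one_pos.trans_le hx.1
  have i1 : IntervalIntegrable (fun x => (b ^ 2 - a ^ 2) * (besselJ0 (a * x) * besselJ0 (b * x)))
      volume 1 R := (hfc.intervalIntegrable _ _).const_mul _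
  have i2 : IntervalIntegrable (fun x => V x / x) volume 1 R :=
    (hVc.continuousOn.div continuousOn_id fun x hx => (hpos x hx).ne').intervalIntegrable
  have h := intervalIntegral.integral_eq_sub_of_hasDerivAt (fun x hx => hV x (hpos x hx))
    (i1.sub i2)
  rw [intervalIntegral.integral_sub i1 i2, intervalIntegral.integral_const_mul] at h
  rw [← intervalIntegral.integral_add_adjacent_intervals (hfc.intervalIntegrable 0 1)
    (hfc.intervalIntegrable 1 R), id, ← h,
    sub_add_cancel, mul_div_cancel_left₀ _ hab]

/-! ### The integral of the triple product -/

lemma tendsto_integral_triple_of_lt {a₁ a₂ a₃ : ℝ} (h : |a₁| + |a₂| < a₃)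
    (h0 : a₁ = 0 ∨ a₁ ≠ 0 ∧ a₂ ≠ 0) :
    Tendsto (fun R => ∫ x in (0 : ℝ)..R,
        besselJ0 (a₁ * x) * besselJ0 (a₂ * x) * besselJ0 (a₃ * x)) atTop
      (𝓝 (∫ z, (a₃ ^ 2 - (a₁ * z.1 + a₂ * z.2) ^ 2) ^ (-1 / 2 : ℝ)
        ∂arcsineMeasure.prod arcsineMeasure)) := by
  have ha : 0 < a₃ := lt_of_le_of_lt (by positivity) h
  obtain ⟨L, hL⟩ : ∃ L, Tendsto (fun R => ∫ x in (0 : ℝ)..R,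
      besselJ0 (a₁ * x) * besselJ0 (a₂ * x) * besselJ0 (a₃ * x)) atTop (𝓝 L) := by
    rcases h0 with rfl | ⟨h₁, h₂⟩
    · obtain ⟨L, hL⟩ := exists_tendsto_integral_besselJ0_mul ha (b := a₂) (by simpa using h)
      refine ⟨L, hL.congr fun R => intervalIntegral.integral_congr fun x _ => ?_⟩
      simp only [zero_mul, besselJ0_zero, one_mul]
      exact mul_comm _ _
    · exact ⟨_, intervalIntegral_tendsto_integral_Ioi 0 (integrableOn_triple h₁ h₂ ha.ne')
        tendsto_id⟩
  have hA := tendsto_integral_exp_mul_of_tendsto (continuous_triple a₁ a₂ a₃)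
    (abs_triple_le_one a₁ a₂ a₃) hL
  rwa [tendsto_nhds_unique hA (tendsto_integral_exp_mul_triple h)] at hL

lemma prodPoly_nonneg (s : ℕ) {x y : ℝ} (hx : 0 ≤ x) (hy : 0 ≤ y) : 0 ≤ prodPoly s x y :=
  mul_nonneg (by positivity) (Finset.sum_nonneg fun _ _ => by positivity)

/-- In the boundary case `|a₁| + |a₂| = a₃` the integral is the limit, by dominated convergence, of
those with a larger third frequency; the terms of the series are non-negative and increase to
their limits, so that the series passes to the limit as well. -/
lemma hasSum_triple_of_le {a₁ a₂ a₃ : ℝ} (h₁ : a₁ ≠ 0) (h₂ : a₂ ≠ 0) (h : |a₁| + |a₂| ≤ a₃) :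
    HasSum (fun s : ℕ => wallisCoeff s ^ 2 * ((s ! : ℝ) * prodPoly s (a₁ ^ 2) (a₂ ^ 2)
        / (a₃ ^ 2) ^ s))
      (a₃ * ∫ x in Set.Ioi (0 : ℝ),
        besselJ0 (a₁ * x) * besselJ0 (a₂ * x) * besselJ0 (a₃ * x)) := by
  have ha : 0 < a₃ := lt_of_lt_of_le (by positivity) h
  let d : ℝ → ℕ → ℝ := fun c s => wallisCoeff s ^ 2 * ((s ! : ℝ) * prodPoly s (a₁ ^ 2) (a₂ ^ 2)
    / (c ^ 2) ^ s)
  let I : ℝ → ℝ := fun c => ∫ x in Set.Ioi (0 : ℝ),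
    besselJ0 (a₁ * x) * besselJ0 (a₂ * x) * besselJ0 (c * x)
  have hd0 : ∀ c s, 0 ≤ d c s := fun c s => by
    have := prodPoly_nonneg s (sq_nonneg a₁) (sq_nonneg a₂)
    positivity
  have hstrict : ∀ c, a₃ < c → HasSum (d c) (c * I c) := by
    intro c hc
    have hlt := h.trans_lt hc
    have e := tendsto_nhds_unique (tendsto_integral_triple_of_lt hlt (Or.inr ⟨h₁, h₂⟩))
      (intervalIntegral_tendsto_integral_Ioi 0 (integrableOn_triple h₁ h₂ (ha.trans hc).ne')
        tendsto_id)
    have := hasSum_wallisCoeff_sq_mul_prodPoly hlt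
    rwa [e] at this
  have hI : Tendsto (fun c => c * I c) (𝓝[>] a₃) (𝓝 (a₃ * I a₃)) := by
    refine (tendsto_id.mono_left nhdsWithin_le_nhds).mul ?_
    obtain ⟨α, hα, k₁, k₂, k₃⟩ := exists_pos_le_abs h₁ h₂ ha.ne'
    refine tendsto_integral_filter_of_dominated_convergence _
      (Eventually.of_forall fun c => (continuous_triple a₁ a₂ c).aestronglyMeasurable) ?_
      (integrable_one_add_norm_rpow (√(1 + 7 / α) ^ 3)).integrableOn (ae_of_all _ fun x => ?_)
    · filter_upwards [self_mem_nhdsWithin] with c hc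
      filter_upwards [ae_restrict_mem measurableSet_Ioi] with x hx
      have hc : a₃ < c := hc
      refine abs_triple_le hα k₁ k₂ (k₃.trans ?_) hx
      rw [abs_of_pos ha, abs_of_pos (ha.trans hc)]
      exact hc.le
    · have hc : Continuous fun c => besselJ0 (a₁ * x) * besselJ0 (a₂ * x) * besselJ0 (c * x) := by
        have := continuous_besselJ0
        fun_prop
      exact (hc.tendsto a₃).mono_left nhdsWithin_le_nhds
  have hdlim : ∀ s, Tendsto (fun c => d c s) (𝓝[>] a₃) (𝓝 (d a₃ s)) := by
    intro s
    have hc : ContinuousAt (fun c => d c s) a₃ := by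
      refine continuousAt_const.mul (continuousAt_const.div (by fun_prop) (by positivity))
    exact hc.tendsto.mono_left nhdsWithin_le_nhds
  have hpart : ∀ u : Finset ℕ, ∑ s ∈ u, d a₃ s ≤ a₃ * I a₃ := by
    intro u
    refine le_of_tendsto_of_tendsto (tendsto_finsetSum u fun s _ => hdlim s) hI ?_
    filter_upwards [self_mem_nhdsWithin] with c hc
    exact sum_le_hasSum u (fun s _ => hd0 c s) (hstrict c hc)
  have hsum : Summable (d a₃) := summable_of_sum_le (hd0 a₃) hpart
  have hle : a₃ * I a₃ ≤ ∑' s, d a₃ s := by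
    refine le_of_tendsto hI ?_
    filter_upwards [self_mem_nhdsWithin] with c hc
    have hc : a₃ < c := hc
    refine hasSum_le (fun s => ?_) (hstrict c hc) hsum.hasSum
    have := prodPoly_nonneg s (sq_nonneg a₁) (sq_nonneg a₂)
    simp only [d]
    gcongr
  have := hsum.hasSum
  rwa [le_antisymm (hsum.tsum_le_of_sum_le hpart) hle] at this

lemma exists_hasSum_and_tendsto_integral_triple {a₁ a₂ a₃ : ℝ} (ha : a₃ ≠ 0)
    (h : (a₁ = 0 ∧ |a₂| < |a₃|) ∨ (a₁ ≠ 0 ∧ a₂ ≠ 0 ∧ |a₁| + |a₂| ≤ |a₃|)) :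
    ∃ T, HasSum (fun s : ℕ => wallisCoeff s ^ 2 * ((s ! : ℝ) * prodPoly s (a₁ ^ 2) (a₂ ^ 2)
        / (a₃ ^ 2) ^ s)) T ∧
      Tendsto (fun R => ∫ x in (0 : ℝ)..R,
        besselJ0 (a₁ * x) * besselJ0 (a₂ * x) * besselJ0 (a₃ * x)) atTop (𝓝 (T / |a₃|)) := by
  have hpos : 0 < |a₃| := abs_pos.2 ha
  simp only [← besselJ0_abs_mul a₃, ← sq_abs a₃]
  rcases h with ⟨rfl, h⟩ | ⟨h₁, h₂, h⟩
  · have h' : |(0 : ℝ)| + |a₂| < |a₃| := by simpa using h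
    refine ⟨_, hasSum_wallisCoeff_sq_mul_prodPoly h', ?_⟩
    rw [mul_div_cancel_left₀ _ hpos.ne']
    exact tendsto_integral_triple_of_lt h' (Or.inl rfl)
  · refine ⟨_, hasSum_triple_of_le h₁ h₂ h, ?_⟩
    rw [mul_div_cancel_left₀ _ hpos.ne']
    exact intervalIntegral_tendsto_integral_Ioi 0 (integrableOn_triple h₁ h₂ hpos.ne') tendsto_id

lemma hasImproperIntegral_of_even {f : ℝ → ℝ} (hf : Continuous f) (heven : ∀ x, f (-x) = f x)
    {L : ℝ} (hL : Tendsto (fun R => ∫ x in (0 : ℝ)..R, f x) atTop (𝓝 L)) :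
    HasImproperIntegral f (2 * L) := by
  refine ⟨fun A B => hf.intervalIntegrable A B, ?_⟩
  have h := ((hL.comp tendsto_neg_atBot_atTop).comp (tendsto_fst (f := atBot) (g := atTop))).add
    (hL.comp (tendsto_snd (f := (atBot : Filter ℝ)) (g := atTop)))
  rw [← two_mul] at h
  refine h.congr fun p => ?_
  have e : ∫ x in (0 : ℝ)..(-p.1), f x = ∫ x in p.1..(0 : ℝ), f x := by
    have := intervalIntegral.integral_comp_neg (a := p.1) (b := 0) f
    simp only [heven, neg_zero] at this
    exact this.symm
  simp only [Function.comp_apply, e]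
  exact intervalIntegral.integral_add_adjacent_intervals (hf.intervalIntegrable _ _)
    (hf.intervalIntegrable _ _)

/-! ### Hypergeometric series and elliptic integrals -/

lemma hasSum_ordinaryHypergeometric_half {k : ℝ} (hk : |k| < 1) :
    HasSum (fun s : ℕ => wallisCoeff s ^ 2 * k ^ (2 * s)) (₂F₁ (1 / 2 : ℝ) (1 / 2 : ℝ) (1 : ℝ)
      (k ^ 2)) := by
  have e : ₂F₁ (1 / 2 : ℝ) (1 / 2 : ℝ) (1 : ℝ) (k ^ 2)
      = ∑' s : ℕ, wallisCoeff s ^ 2 * k ^ (2 * s) := by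
    rw [ordinaryHypergeometric_eq_tsum]
    refine tsum_congr fun s => ?_
    rw [pow_mul, ← ordinaryHypergeometricCoefficient_half, smul_eq_mul]
  rw [e]
  refine Summable.hasSum (Summable.of_nonneg_of_le (fun s => ?_) (fun s => ?_)
    (hasSum_wallisCoeff_mul_pow (z := k ^ 2) ?_).summable)
  · rw [pow_mul]; positivity
  · rw [pow_mul, sq (wallisCoeff s), mul_assoc]
    have := wallisCoeff_pos s
    exact mul_le_of_le_one_left (by positivity) (wallisCoeff_le_one s)
  · rw [abs_of_nonneg (sq_nonneg k)]; exact (sq_lt_one_iff_abs_lt_one k).2 hk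

lemma integral_sin_pow_even_half (n : ℕ) :
    ∫ θ in (0 : ℝ)..(Real.pi / 2), Real.sin θ ^ (2 * n) = Real.pi / 2 * wallisCoeff n := by
  induction n with
  | zero => simp [wallisCoeff_zero]
  | succ n ih =>
    rw [mul_add, mul_one, integral_sin_pow, ih, wallisCoeff_succ]
    simp
    ring

lemma ordinaryHypergeometric_half_eq_ellipticK {k : ℝ} (hk : |k| < 1) :
    ₂F₁ (1 / 2 : ℝ) (1 / 2 : ℝ) (1 : ℝ) (k ^ 2) = 2 / Real.pi * ellipticK k := by
  have hk2 : k ^ 2 < 1 := (sq_lt_one_iff_abs_lt_one k).2 hk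
  have hz : ∀ θ : ℝ, 0 ≤ k ^ 2 * Real.sin θ ^ 2 ∧ k ^ 2 * Real.sin θ ^ 2 ≤ k ^ 2 := fun θ =>
    ⟨by positivity, mul_le_of_le_one_right (sq_nonneg k) (Real.sin_sq_le_one θ)⟩
  have h := intervalIntegral.hasSum_integral_of_dominated_convergence (μ := volume) (a := 0)
    (b := Real.pi / 2)
    (F := fun (s : ℕ) θ => wallisCoeff s * (k ^ 2 * Real.sin θ ^ 2) ^ s)
    (f := fun θ => 1 / √(1 - k ^ 2 * Real.sin θ ^ 2))
    (fun s _ => wallisCoeff s * (k ^ 2) ^ s)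
    (fun s => Continuous.aestronglyMeasurable (by fun_prop))
    (fun s => ae_of_all _ fun θ _ => ?_)
    (ae_of_all _ fun _ _ => (hasSum_wallisCoeff_mul_pow (z := k ^ 2)
      (by rwa [abs_of_nonneg (sq_nonneg k)])).summable)
    (_root_.intervalIntegrable_const) (ae_of_all _ fun θ _ => ?_)
  · refine (hasSum_ordinaryHypergeometric_half hk).unique ?_
    convert! h.mul_left (2 / Real.pi) using 2 with s
    have e : ∀ θ : ℝ, wallisCoeff s * (k ^ 2 * Real.sin θ ^ 2) ^ s
        = wallisCoeff s * k ^ (2 * s) * Real.sin θ ^ (2 * s) := fun θ => by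
      rw [mul_pow, ← pow_mul, ← pow_mul]; ring
    simp only [e]
    rw [intervalIntegral.integral_const_mul, integral_sin_pow_even_half]
    have := Real.pi_ne_zero
    field_simp
  · have := wallisCoeff_pos s
    rw [Real.norm_of_nonneg (by positivity)]
    gcongr
    exact (hz θ).2
  · have h1 := hasSum_wallisCoeff_mul_pow (z := k ^ 2 * Real.sin θ ^ 2)
      (by rw [abs_of_nonneg (hz θ).1]; exact (hz θ).2.trans_lt hk2)
    have hpos : 0 < 1 - k ^ 2 * Real.sin θ ^ 2 := by linarith [(hz θ).2]
    rwa [show (-1 / 2 : ℝ) = -(1 / 2) by norm_num, Real.rpow_neg hpos.le, ← Real.sqrt_eq_rpow,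
      ← one_div] at h1

/-! ### The functions `l_ν` at `ν = -1/2` -/

lemma sq_rpow_neg_half_add {a : ℝ} (ha : a ≠ 0) (s : ℕ) :
    (a ^ 2) ^ (-(1 / 2 + (s : ℝ))) = |a|⁻¹ * ((a ^ 2) ^ s)⁻¹ := by
  have : 0 < a ^ 2 := by positivity
  rw [Real.rpow_neg this.le, Real.rpow_add this, Real.rpow_natCast, ← Real.sqrt_eq_rpow,
    Real.sqrt_sq_eq_abs, mul_inv]

lemma hasSum_prodFun_neg_half {a b T : ℝ} (ha : a ≠ 0)
    (hT : HasSum (fun s : ℕ => wallisCoeff s ^ 2 * (b / a) ^ (2 * s)) T) :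
    HasSum (fun s : ℕ => Real.Gamma (1 / 2) * ((a ^ 2) ^ (-(1 / 2 + (s : ℝ))) * b ^ (2 * s) /
        ((s ! : ℝ) ^ 2 * Real.Gamma (1 / 2 - s) ^ 2))) (prodFun (-1 / 2) (a ^ 2) (b ^ 2)) ∧
      prodFun (-1 / 2) (a ^ 2) (b ^ 2) = 1 / (√Real.pi * |a|) * T := by
  have h : HasSum (fun s : ℕ => Real.Gamma (1 / 2) * ((a ^ 2) ^ (-(1 / 2 + (s : ℝ))) * b ^ (2 * s) /
      ((s ! : ℝ) ^ 2 * Real.Gamma (1 / 2 - s) ^ 2))) (1 / (√Real.pi * |a|) * T) := by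
    convert! hT.mul_left (1 / (√Real.pi * |a|)) using 2 with s
    have hs : (s ! : ℝ) ≠ 0 := by positivity
    have e := Gamma_half_div_sq s
    calc _ = Real.Gamma (1 / 2) * (Real.Gamma (1 / 2 - s) ^ 2)⁻¹ *
          ((a ^ 2) ^ (-(1 / 2 + (s : ℝ))) * b ^ (2 * s) / (s ! : ℝ) ^ 2) := by
            rw [div_mul_eq_div_div_swap, div_eq_mul_inv, div_eq_mul_inv, div_eq_mul_inv]; ring
      _ = _ := by
        rw [e, sq_rpow_neg_half_add ha, div_pow, pow_mul a]
        have : √Real.pi ≠ 0 := by positivity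
        have : |a| ≠ 0 := abs_ne_zero.2 ha
        field_simp
  have e : prodFun (-1 / 2) (a ^ 2) (b ^ 2) = 1 / (√Real.pi * |a|) * T := by
    rw [← h.tsum_eq, tsum_mul_left, prodFun]
    congr 1
    · norm_num
    · refine tsum_congr fun s => ?_
      rw [show (-1 / 2 - (s : ℝ)) = -(1 / 2 + (s : ℝ)) by ring,
        show -(1 / 2 + (s : ℝ)) + 1 = 1 / 2 - s by ring, pow_mul b]
  exact ⟨e ▸ h, e⟩

lemma hasSum_prodFun3_neg_half {a₁ a₂ a₃ T : ℝ} (ha : a₃ ≠ 0)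
    (hT : HasSum (fun s : ℕ => wallisCoeff s ^ 2 * ((s ! : ℝ) * prodPoly s (a₁ ^ 2) (a₂ ^ 2)
      / (a₃ ^ 2) ^ s)) T) :
    HasSum (fun s : ℕ => Real.Gamma (1 / 2) * ((a₃ ^ 2) ^ (-(1 / 2 + (s : ℝ))) /
        ((s ! : ℝ) * Real.Gamma (1 / 2 - s) ^ 2) * prodPoly s (a₁ ^ 2) (a₂ ^ 2)))
        (prodFun3 (-1 / 2) (a₁ ^ 2) (a₂ ^ 2) (a₃ ^ 2)) ∧
      prodFun3 (-1 / 2) (a₁ ^ 2) (a₂ ^ 2) (a₃ ^ 2) = 1 / (√Real.pi * |a₃|) * T := by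
  have h : HasSum (fun s : ℕ => Real.Gamma (1 / 2) * ((a₃ ^ 2) ^ (-(1 / 2 + (s : ℝ))) /
        ((s ! : ℝ) * Real.Gamma (1 / 2 - s) ^ 2) * prodPoly s (a₁ ^ 2) (a₂ ^ 2)))
      (1 / (√Real.pi * |a₃|) * T) := by
    convert! hT.mul_left (1 / (√Real.pi * |a₃|)) using 2 with s
    have hs : (s ! : ℝ) ≠ 0 := by positivity
    have e := Gamma_half_div_sq s
    calc _ = Real.Gamma (1 / 2) * (Real.Gamma (1 / 2 - s) ^ 2)⁻¹ *
          ((a₃ ^ 2) ^ (-(1 / 2 + (s : ℝ))) / (s ! : ℝ) * prodPoly s (a₁ ^ 2) (a₂ ^ 2)) := by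
            rw [div_mul_eq_div_div_swap, div_eq_mul_inv, div_eq_mul_inv, div_eq_mul_inv]; ring
      _ = _ := by
        rw [e, sq_rpow_neg_half_add ha]
        have : √Real.pi ≠ 0 := by positivity
        have : |a₃| ≠ 0 := abs_ne_zero.2 ha
        field_simp
  have e : prodFun3 (-1 / 2) (a₁ ^ 2) (a₂ ^ 2) (a₃ ^ 2) = 1 / (√Real.pi * |a₃|) * T := by
    rw [← h.tsum_eq, tsum_mul_left, prodFun3]
    congr 1
    · norm_num
    · refine tsum_congr fun s => ?_
      rw [show (-1 / 2 - (s : ℝ)) = -(1 / 2 + (s : ℝ)) by ring,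
        show -(1 / 2 + (s : ℝ)) + 1 = 1 / 2 - s by ring]
  exact ⟨e ▸ h, e⟩

lemma factorial_mul_prodPoly_zero (s : ℕ) (y : ℝ) : (s ! : ℝ) * prodPoly s 0 y = y ^ s := by
  rw [prodPoly, Finset.sum_eq_single s]
  · have : (s ! : ℝ) ≠ 0 := by positivity
    simp
    field_simp
  · intro k hk hks
    have : s - k ≠ 0 := by simp at hk; omega
    simp [this]
  · simp

/-! ### The integrals and series -/

theorem mainTheorem10 :
    -- series expansion of the product of two Bessel functions
    (∀ a b x : ℝ,
      HasSum (fun r : ℕ => (-1 : ℝ) ^ r / (r ! : ℝ) * prodPoly r (a ^ 2) (b ^ 2)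
          * (x / 2) ^ (2 * r))
        (besselJ0 (a * x) * besselJ0 (b * x))) ∧
    -- the functions `l_ν` extend the polynomials `l_r`
    (∀ (r : ℕ) (x y : ℝ), prodFun r x y = prodPoly r x y) ∧
    -- the integral of the product of two Bessel functions
    (∀ a b : ℝ, |b| < |a| →
      HasImproperIntegral (fun x => besselJ0 (a * x) * besselJ0 (b * x))
        (2 * √Real.pi * prodFun (-1 / 2) (a ^ 2) (b ^ 2)) ∧
      HasSum (fun s : ℕ => Real.Gamma (1 / 2) *
          ((a ^ 2) ^ (-(1 / 2 + (s : ℝ))) * b ^ (2 * s) /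
            ((s ! : ℝ) ^ 2 * Real.Gamma (1 / 2 - s) ^ 2)))
        (prodFun (-1 / 2) (a ^ 2) (b ^ 2)) ∧
      prodFun (-1 / 2) (a ^ 2) (b ^ 2) =
        1 / (√Real.pi * |a|) * ₂F₁ (1 / 2 : ℝ) (1 / 2 : ℝ) (1 : ℝ) ((b / a) ^ 2) ∧
      2 * √Real.pi * prodFun (-1 / 2) (a ^ 2) (b ^ 2) =
        4 / (Real.pi * |a|) * ellipticK (b / a)) ∧
    -- the hypergeometric series and the complete elliptic integral of the first kind
    (∀ k : ℝ, |k| < 1 →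
      HasSum (fun s : ℕ =>
          (((2 * s)! : ℝ) / (2 ^ (2 * s) * (s ! : ℝ) ^ 2)) ^ 2 * k ^ (2 * s))
        (₂F₁ (1 / 2 : ℝ) (1 / 2 : ℝ) (1 : ℝ) (k ^ 2)) ∧
      ₂F₁ (1 / 2 : ℝ) (1 / 2 : ℝ) (1 : ℝ) (k ^ 2) = 2 / Real.pi * ellipticK k) ∧
    -- series expansion of the product of three Bessel functions
    (∀ a₁ a₂ a₃ x : ℝ,
      HasSum (fun r : ℕ => (-1 : ℝ) ^ r / (r ! : ℝ) * prodPoly3 r (a₁ ^ 2) (a₂ ^ 2) (a₃ ^ 2)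
          * (x / 2) ^ (2 * r))
        (besselJ0 (a₁ * x) * besselJ0 (a₂ * x) * besselJ0 (a₃ * x))) ∧
    (∀ (r : ℕ) (x₁ x₂ x₃ : ℝ), prodFun3 r x₁ x₂ x₃ = prodPoly3 r x₁ x₂ x₃) ∧
    -- the integral of the product of three Bessel functions
    (∀ a₁ a₂ a₃ : ℝ, |a₁| < |a₂| → |a₂| < |a₃| → |a₁| + |a₂| ≤ |a₃| →
      HasImproperIntegral
        (fun x => besselJ0 (a₁ * x) * besselJ0 (a₂ * x) * besselJ0 (a₃ * x))
        (2 * √Real.pi * prodFun3 (-1 / 2) (a₁ ^ 2) (a₂ ^ 2) (a₃ ^ 2)) ∧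
      HasSum (fun s : ℕ => Real.Gamma (1 / 2) *
          ((a₃ ^ 2) ^ (-(1 / 2 + (s : ℝ))) /
            ((s ! : ℝ) * Real.Gamma (1 / 2 - s) ^ 2) * prodPoly s (a₁ ^ 2) (a₂ ^ 2)))
        (prodFun3 (-1 / 2) (a₁ ^ 2) (a₂ ^ 2) (a₃ ^ 2)) ∧
      prodFun3 (-1 / 2) (a₁ ^ 2) (a₂ ^ 2) (a₃ ^ 2) =
        1 / (√Real.pi * |a₃|) *
          umbral2F1 (1 / 2) (1 / 2) 1
            (fun s : ℕ => (s ! : ℝ) * prodPoly s (a₁ ^ 2) (a₂ ^ 2)) (1 / a₃ ^ 2) ∧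
      HasSum (fun s : ℕ =>
          (((2 * s)! : ℝ) / (2 ^ (2 * s) * (s ! : ℝ) ^ 2)) ^ 2 *
            ((s ! : ℝ) * prodPoly s (a₁ ^ 2) (a₂ ^ 2) / (a₃ ^ 2) ^ s))
        (umbral2F1 (1 / 2) (1 / 2) 1
          (fun s : ℕ => (s ! : ℝ) * prodPoly s (a₁ ^ 2) (a₂ ^ 2)) (1 / a₃ ^ 2))) := by
  refine ⟨hasSum_besselJ0_mul, prodFun_natCast, fun a b hab => ?_, fun k hk =>
    ⟨hasSum_ordinaryHypergeometric_half hk, ordinaryHypergeometric_half_eq_ellipticK hk⟩,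
    hasSum_besselJ0_mul_mul, prodFun3_natCast, fun a₁ a₂ a₃ h₁₂ h₂₃ hle => ?_⟩
  · have ha : a ≠ 0 := abs_pos.1 ((abs_nonneg b).trans_lt hab)
    have hk : |b / a| < 1 := by rwa [abs_div, div_lt_one (abs_pos.2 ha)]
    -- The product of two factors is the product of three with the first frequency equal to zero.
    obtain ⟨T, hT, hlim⟩ := exists_hasSum_and_tendsto_integral_triple ha
      (Or.inl ⟨rfl, hab⟩ : ((0 : ℝ) = 0 ∧ |b| < |a|) ∨ _)
    have hT' : T = ₂F₁ (1 / 2 : ℝ) (1 / 2 : ℝ) (1 : ℝ) ((b / a) ^ 2) := by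
      refine hT.unique ?_
      convert! hasSum_ordinaryHypergeometric_half hk using 2 with s
      rw [zero_pow two_ne_zero, factorial_mul_prodPoly_zero, ← div_pow, ← div_pow, pow_mul]
    obtain ⟨hsum, hval⟩ := hasSum_prodFun_neg_half ha (hasSum_ordinaryHypergeometric_half hk)
    have hpi : √Real.pi ≠ 0 := by positivity
    have ha' : |a| ≠ 0 := abs_ne_zero.2 ha
    refine ⟨?_, hsum, hval, ?_⟩
    · rw [hval, ← hT', show 2 * √Real.pi * (1 / (√Real.pi * |a|) * T) = 2 * (T / |a|) by
        field_simp]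
      refine hasImproperIntegral_of_even ?_ (fun x => ?_) ?_
      · have := continuous_besselJ0
        fun_prop
      · simp only [mul_neg, besselJ0_neg]
      · simpa only [zero_mul, besselJ0_zero, one_mul, mul_comm (besselJ0 (b * _))] using hlim
    · rw [hval, ordinaryHypergeometric_half_eq_ellipticK hk]
      field_simp
      ring
  · have ha : a₃ ≠ 0 := abs_pos.1 ((abs_nonneg a₂).trans_lt h₂₃)
    have ha₂ : a₂ ≠ 0 := abs_pos.1 ((abs_nonneg a₁).trans_lt h₁₂)
    obtain ⟨T, hT, hlim⟩ := exists_hasSum_and_tendsto_integral_triple (a₁ := a₁) (a₂ := a₂) ha (by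
      by_cases h : a₁ = 0
      · exact Or.inl ⟨h, h₂₃⟩
      · exact Or.inr ⟨h, ha₂, hle⟩)
    obtain ⟨hsum, hval⟩ := hasSum_prodFun3_neg_half ha hT
    have hF : umbral2F1 (1 / 2) (1 / 2) 1
        (fun s : ℕ => (s ! : ℝ) * prodPoly s (a₁ ^ 2) (a₂ ^ 2)) (1 / a₃ ^ 2) = T := by
      rw [← hT.tsum_eq, umbral2F1]
      refine tsum_congr fun s => ?_
      rw [ordinaryHypergeometricCoefficient_half, one_div_pow, mul_one_div]
    have hpi : √Real.pi ≠ 0 := by positivity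
    have ha' : |a₃| ≠ 0 := abs_ne_zero.2 ha
    refine ⟨?_, hsum, ?_, ?_⟩
    · rw [hval, show 2 * √Real.pi * (1 / (√Real.pi * |a₃|) * T) = 2 * (T / |a₃|) by field_simp]
      refine hasImproperIntegral_of_even (continuous_triple a₁ a₂ a₃) (fun x => ?_) hlim
      simp only [mul_neg, besselJ0_neg]
    · rw [hval, hF]
    · rw [hF]
      exact hT
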